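/- **Setting.** Let $(\Omega,\mathcal F,(\mathcal F_t)_{t\in\mathbb N},\mathbb P)$ be a filtered probability space, $d\ge 1$, and let $S(t)=(S_1(t),\dots,S_d(t))$, $t=0,1,2,\dots$, be an adapted price process with strictly positive coordinates. Put $r_i(t)=\ln\frac{S_i(t)}{S_i(t-1)}$ and $w_i(t)=e^{r_i(t)}$ for $t\ge1$. Assume that the vectors $r(t)$, $t\ge 1$, are i.i.d. and that $r(t+1)$ is independent of $\mathcal F_t$ for every $t\ge0$. Let $c,h\in(0,1)^d$ be cost rates and $d(x)=\langle c,[x]^+\rangle+\langle h,[x]^-\rangle$ the proportional transaction cost penalty on $\mathbb R^d$. Let $\mathcal S=\{x\in\mathbb R^d: x_j\ge0,\ \sum_j x_j=1\}$ and $G(x,y)=\big(x_iy_i/\langle x,y\rangle\big)_{i}$. For $x,y\in\mathcal S$ let $s(x,y)\in(0,1]$ be the unique solution $s$ of $s+d(sy-x)=1$. For $\gamma>0$ and a random variable $X$ let $\mu^\gamma(X)=\frac1\gamma\ln\mathbb E[e^{\gamma X}]$. The initial endowment is a nonnegative $\mathcal F_0$-measurable vector $N(0-)$ of asset volumes such that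 $W(0-)=\langle N(0-),S(0)\rangle>0$ and $\mathbb E[W(0-)^\gamma]<\infty$ (for instance, $W(0-)$ is a positive constant). A strategy is an adapted $\mathcal S$-valued process $\pi=(\pi(t))_{t\ge0}$. Writing $N(t-)=N(t-1)$ for $t\ge1$, $W_\pi(t-)=\langle N(t-),S(t)\rangle$ and $\pi(t-)=\big(N_i(t-)S_i(t)/W_\pi(t-)\big)_i$, the strategy leads to the wealth $W_\pi(t)=W_\pi(t-)\,s(\pi(t-),\pi(t))$ and the holdings $N_i(t)=W_\pi(t)\pi_i(t)/S_i(t)$; equivalently, the self-financing condition $W_\pi(t)=W_\pi(t-)-d\big((N(t)-N(t-))\cdot S(t)\big)$ holds (with $\cdot$ the coordinatewise product), and $\pi((t+1)-)=G(\pi(t),w(t+1))$. The objective is $$J(\pi)=\liminf_{n\to\infty}\frac1n\,\mu^\gamma\big(\ln W_\pi(n-)\big).$$ **Theorem.** Let $\gamma>0$ and assume (A.1): $\mathbb E[e^{\gamma r_i(1)}]<\infty$ and $\mathbb E|r_i(1)|<\infty$ for $i=1,\dots,d$. Then there exist a constant $\lambda\in\mathbb R$ and a continuous bounded function $v(\cdot,\gamma):\mathcal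 S\to\mathbb R$ such that, for every $\pi\in\mathcal S$, $$v(\pi,\gamma)+\lambda=\gamma\sup_{\pi'\in\mathcal S}\Big[\mu^\gamma\Big(\ln\langle\pi',w(1)\rangle+\ln s(\pi,\pi')+\gamma^{-1}v\big(G(\pi',w(1)),\gamma\big)\Big)\Big].$$ Moreover, for every initial endowment as above, $\Lambda:=\lambda/\gamma$ is the optimal value, i.e. $\Lambda=\sup_\pi J(\pi)$, the supremum being over all strategies. The selectors of the Bellman equation give optimal strategies: there is a Borel map $u:\mathcal S\to\mathcal S$ such that for every $\pi\in\mathcal S$ the supremum is attained at $\pi'=u(\pi)$, and for every such Borel map $u$ and every initial endowment the process $\pi^*(t)=u(\pi^*(t-))$, $t\ge0$, is a strategy with $J(\pi^*)=\Lambda$. -/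

import Mathlib

open MeasureTheory ProbabilityTheory Filter

namespace RiskSensitive

noncomputable section

/-- The proportional transaction cost penalty `d(x) = ⟨c, [x]⁺⟩ + ⟨h, [x]⁻⟩`. -/
def cost {d : ℕ} (c h x : Fin d → ℝ) : ℝ := c ⬝ᵥ x⁺ + h ⬝ᵥ x⁻

/-- The capital decay `s(x, y)` caused by rebalancing the weights from `x` to `y`: the solution `w`
of `w + d(w y - x) = 1`.  For `x`, `y` in the simplex it exists and is unique, see
`existsUnique_decay`. -/
def decay {d : ℕ} (c h x y : Fin d → ℝ) : ℝ :=
  Classical.epsilon fun w : ℝ => w + cost c h (w • y - x) = 1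

/-- `G(x, y) = x · y / ⟨x, y⟩`: the weights `x` after a relative price shift `y`. -/
def drift {d : ℕ} (x y : Fin d → ℝ) : Fin d → ℝ := fun i => x i * y i / (x ⬝ᵥ y)

/-- The log-returns `r_i(t) = ln (S_i(t) / S_i(t-1))`, for `t ≥ 1`. -/
def logReturn {Ω : Type*} {d : ℕ} (S : ℕ → Ω → Fin d → ℝ) (t : ℕ) (ω : Ω) : Fin d → ℝ :=
  fun i => Real.log (S t ω i / S (t - 1) ω i)

/-- The relative price shifts `w_i(t) = exp (r_i(t))`, for `t ≥ 1`. -/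
def shift {Ω : Type*} {d : ℕ} (S : ℕ → Ω → Fin d → ℝ) (t : ℕ) (ω : Ω) : Fin d → ℝ :=
  fun i => Real.exp (logReturn S t ω i)

/-- The entropic utility `μ^γ(X) = (1/γ) ln E[exp (γ X)]`, with values in `[-∞, ∞]`. -/
def entropic {Ω : Type*} [MeasurableSpace Ω] (P : Measure Ω) (γ : ℝ) (X : Ω → ℝ) : EReal :=
  ((1 / γ : ℝ) : EReal) * ENNReal.log (∫⁻ ω, ENNReal.ofReal (Real.exp (γ * X ω)) ∂P)

/-- `preHoldings c h N₀ S π t` is the vector `N(t-)` of asset volumes held at time `t` before the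
rebalancing of that time, when the initial endowment is `N(0-) = N₀` and, at every time `t`, the
portfolio is rebalanced to the weights `π t`.  In particular `preHoldings c h N₀ S π (t + 1)` is
`N(t) = N((t+1)-)`, with `N_i(t) = W(t) π_i(t) / S_i(t)` and `W(t) = W(t-) s(π(t-), π(t))`.
The self-financing condition is checked in `selfFinancing`. -/
def preHoldings {Ω : Type*} {d : ℕ} (c h : Fin d → ℝ) (N₀ : Ω → Fin d → ℝ)
    (S π : ℕ → Ω → Fin d → ℝ) : ℕ → Ω → Fin d → ℝ
  | 0, ω => N₀ ω
  | t + 1, ω => fun i =>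
      (preHoldings c h N₀ S π t ω ⬝ᵥ S t ω)
        * decay c h (drift (preHoldings c h N₀ S π t ω) (S t ω)) (π t ω) * π t ω i / S t ω i

/-- The wealth `W_π(t-) = ⟨N(t-), S(t)⟩` before the rebalancing at time `t`. -/
def wealthPre {Ω : Type*} {d : ℕ} (c h : Fin d → ℝ) (N₀ : Ω → Fin d → ℝ)
    (S π : ℕ → Ω → Fin d → ℝ) (t : ℕ) (ω : Ω) : ℝ :=
  preHoldings c h N₀ S π t ω ⬝ᵥ S t ω

/-- The long-run risk-sensitive objective `J(π) = liminf_n (1/n) μ^γ(ln W_π(n-))`. -/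
def objective {Ω : Type*} [MeasurableSpace Ω] {d : ℕ} (P : Measure Ω) (γ : ℝ) (c h : Fin d → ℝ)
    (N₀ : Ω → Fin d → ℝ) (S π : ℕ → Ω → Fin d → ℝ) : EReal :=
  liminf (fun n : ℕ =>
    entropic P γ (fun ω => Real.log (wealthPre c h N₀ S π n ω)) / (n : EReal)) atTop

/-- The admissible strategies: adapted processes with values in the simplex. -/
def strategies {Ω : Type*} {m : MeasurableSpace Ω} (ℱ : Filtration ℕ m) (d : ℕ) :
    Set (ℕ → Ω → Fin d → ℝ) :=
  {π | (∀ t, Measurable[ℱ t] (π t)) ∧ ∀ t ω, π t ω ∈ stdSimplex ℝ (Fin d)}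

/-- The expression `μ^γ(ln⟨y, w⟩ + ln s(x, y) + γ⁻¹ v(G(y, w)))` that is maximised over `y` in the
Bellman equation. -/
def bellmanTerm {Ω : Type*} [MeasurableSpace Ω] {d : ℕ} (P : Measure Ω) (γ : ℝ) (c h : Fin d → ℝ)
    (w : Ω → Fin d → ℝ) (v : (Fin d → ℝ) → ℝ) (x y : Fin d → ℝ) : EReal :=
  entropic P γ fun ω =>
    Real.log (y ⬝ᵥ w ω) + Real.log (decay c h x y) + γ⁻¹ * v (drift y (w ω))

/-- `u` is a Borel measurable selector of the Bellman equation: for every `x` in the simplex, `u x`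
is a point of the simplex at which the supremum is attained. -/
def IsSelector {Ω : Type*} [MeasurableSpace Ω] {d : ℕ} (P : Measure Ω) (γ : ℝ) (c h : Fin d → ℝ)
    (w : Ω → Fin d → ℝ) (v : (Fin d → ℝ) → ℝ) (u : (Fin d → ℝ) → Fin d → ℝ) : Prop :=
  Measurable u ∧ ∀ x ∈ stdSimplex ℝ (Fin d), u x ∈ stdSimplex ℝ (Fin d) ∧
    IsMaxOn (bellmanTerm P γ c h w v x) (stdSimplex ℝ (Fin d)) (u x)

/-- The strategy generated by `u`: `π(t) = u(π(t-))`, where `π(0-)` are the weights of the initial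
endowment and `π((t+1)-) = G(π(t), w(t+1))`. -/
def feedback {Ω : Type*} {d : ℕ} (N₀ : Ω → Fin d → ℝ) (S : ℕ → Ω → Fin d → ℝ)
    (u : (Fin d → ℝ) → Fin d → ℝ) : ℕ → Ω → Fin d → ℝ
  | 0, ω => u (drift (N₀ ω) (S 0 ω))
  | t + 1, ω => u (drift (feedback N₀ S u t ω) (shift S (t + 1) ω))

theorem cost_eq {d : ℕ} (c h x : Fin d → ℝ) :
    cost c h x = ∑ i, (c i * max (x i) 0 + h i * max (-x i) 0) := by
  simp [cost, dotProduct, Finset.sum_add_distrib, posPart_def, negPart_def]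

theorem sum_mul_lt_one {d : ℕ} {h y : Fin d → ℝ} (hh : ∀ i, 0 < h i ∧ h i < 1)
    (hy : y ∈ stdSimplex ℝ (Fin d)) : ∑ i, h i * y i < 1 := by
  have h1 : ∑ i, y i = 1 := hy.2
  obtain ⟨i, hi⟩ : ∃ i, 0 < y i := by
    by_contra! hcon
    have : ∑ i, y i ≤ 0 := Finset.sum_nonpos fun i _ => hcon i
    linarith
  rw [← h1]
  refine Finset.sum_lt_sum (fun j _ => ?_) ⟨i, Finset.mem_univ i, ?_⟩
  · nlinarith [hy.1 j, (hh j).2]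
  · nlinarith [(hh i).2]

theorem strictMono_rebalance {d : ℕ} {c h x y : Fin d → ℝ}
    (hc : ∀ i, 0 < c i ∧ c i < 1) (hh : ∀ i, 0 < h i ∧ h i < 1)
    (hy : y ∈ stdSimplex ℝ (Fin d)) :
    StrictMono fun w : ℝ => w + cost c h (w • y - x) := by
  intro a b hab
  have key : ∑ i, (-(h i * y i) * (b - a)) ≤ cost c h (b • y - x) - cost c h (a • y - x) := by
    rw [cost_eq, cost_eq, ← Finset.sum_sub_distrib]
    refine Finset.sum_le_sum fun i _ => ?_
    simp only [Pi.sub_apply, Pi.smul_apply, smul_eq_mul]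
    have hz : a * y i - x i ≤ b * y i - x i := by
      have := mul_le_mul_of_nonneg_right hab.le (hy.1 i)
      linarith
    have e : -(h i * y i) * (b - a) = -h i * ((b * y i - x i) - (a * y i - x i)) := by ring
    rw [e]
    generalize b * y i - x i = p at hz ⊢
    generalize a * y i - x i = q at hz ⊢
    have h1 : max q 0 ≤ max p 0 := max_le_max_right 0 hz
    have h2 : max (-q) 0 - max (-p) 0 ≤ p - q := by
      rcases le_total (-q) 0 with hq | hq <;> rcases le_total (-p) 0 with hp | hp <;>
        simp only [max_eq_left, max_eq_right, hq, hp] <;> linarith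
    have h3 := mul_le_mul_of_nonneg_left h1 (hc i).1.le
    have h4 := mul_le_mul_of_nonneg_left h2 (hh i).1.le
    linarith
  rw [← Finset.sum_mul, Finset.sum_neg_distrib] at key
  have := sum_mul_lt_one hh hy
  show a + cost c h (a • y - x) < b + cost c h (b • y - x)
  nlinarith

theorem cost_nonneg {d : ℕ} {c h : Fin d → ℝ}
    (hc : ∀ i, 0 < c i ∧ c i < 1) (hh : ∀ i, 0 < h i ∧ h i < 1) (x : Fin d → ℝ) :
    0 ≤ cost c h x := by
  rw [cost_eq]
  refine Finset.sum_nonneg fun i _ => add_nonneg ?_ ?_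
  · exact mul_nonneg (hc i).1.le (le_max_right _ _)
  · exact mul_nonneg (hh i).1.le (le_max_right _ _)

theorem rebalance_zero_lt {d : ℕ} {c h x y : Fin d → ℝ} (hh : ∀ i, 0 < h i ∧ h i < 1)
    (hx : x ∈ stdSimplex ℝ (Fin d)) : (0 : ℝ) + cost c h ((0 : ℝ) • y - x) < 1 := by
  rw [cost_eq, zero_add]
  refine lt_of_eq_of_lt (Finset.sum_congr rfl fun i _ => ?_) (sum_mul_lt_one hh hx)
  simp [hx.1 i]

/-- The equation that defines `decay` has exactly one solution. -/
theorem existsUnique_decay {d : ℕ} {c h x y : Fin d → ℝ}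
    (hc : ∀ i, 0 < c i ∧ c i < 1) (hh : ∀ i, 0 < h i ∧ h i < 1)
    (hx : x ∈ stdSimplex ℝ (Fin d)) (hy : y ∈ stdSimplex ℝ (Fin d)) :
    ∃! w : ℝ, w + cost c h (w • y - x) = 1 := by
  have hcont : Continuous fun w : ℝ => w + cost c h (w • y - x) := by
    simp only [cost_eq, Pi.sub_apply, Pi.smul_apply]
    fun_prop
  have h0 := rebalance_zero_lt (c := c) (y := y) hh hx
  have h1 := cost_nonneg hc hh ((1 : ℝ) • y - x)
  obtain ⟨w, -, hw⟩ := intermediate_value_Icc (zero_le_one (α := ℝ)) hcont.continuousOn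
    (show (1 : ℝ) ∈ Set.Icc _ _ from ⟨h0.le, by linarith⟩)
  exact ⟨w, hw, fun z hz => (strictMono_rebalance hc hh hy).injective (hz.trans hw.symm)⟩

theorem decay_spec {d : ℕ} {c h x y : Fin d → ℝ}
    (hc : ∀ i, 0 < c i ∧ c i < 1) (hh : ∀ i, 0 < h i ∧ h i < 1)
    (hx : x ∈ stdSimplex ℝ (Fin d)) (hy : y ∈ stdSimplex ℝ (Fin d)) :
    (0 < decay c h x y ∧ decay c h x y ≤ 1) ∧
      decay c h x y + cost c h (decay c h x y • y - x) = 1 := by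
  have hs : decay c h x y + cost c h (decay c h x y • y - x) = 1 :=
    Classical.epsilon_spec (existsUnique_decay hc hh hx hy).exists
  refine ⟨⟨?_, ?_⟩, hs⟩
  · have h0 := rebalance_zero_lt (c := c) (y := y) hh hx
    rw [← hs] at h0
    exact (strictMono_rebalance hc hh hy).lt_iff_lt.mp h0
  · linarith [cost_nonneg hc hh (decay c h x y • y - x)]

theorem drift_mem {d : ℕ} {x y : Fin d → ℝ} (hx : ∀ i, 0 ≤ x i) (hy : ∀ i, 0 < y i)
    (hxy : 0 < x ⬝ᵥ y) : drift x y ∈ stdSimplex ℝ (Fin d) := by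
  refine ⟨fun i => div_nonneg (mul_nonneg (hx i) (hy i).le) hxy.le, ?_⟩
  simp only [drift]
  rw [← Finset.sum_div]
  exact div_self hxy.ne'

theorem cost_smul {d : ℕ} {c h : Fin d → ℝ} {a : ℝ} (ha : 0 ≤ a) (x : Fin d → ℝ) :
    cost c h (a • x) = a * cost c h x := by
  rw [cost_eq, cost_eq, Finset.mul_sum]
  refine Finset.sum_congr rfl fun i _ => ?_
  have e1 : max (a * x i) 0 = a * max (x i) 0 := by
    rw [mul_max_of_nonneg _ _ ha, mul_zero]
  have e2 : max (-(a * x i)) 0 = a * max (-x i) 0 := by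
    rw [mul_max_of_nonneg _ _ ha, mul_zero, mul_neg]
  simp only [Pi.smul_apply, smul_eq_mul, e1, e2]
  ring

/-- The holdings stay nonnegative, the wealth stays positive, the portfolio has weights `π t` after
the rebalancing at time `t`, and the self-financing condition
`W(t) = W(t-) - d((N(t) - N(t-1)) · S(t))` holds. -/
theorem selfFinancing {Ω : Type*} {d : ℕ} {c h : Fin d → ℝ} {N₀ : Ω → Fin d → ℝ}
    {S π : ℕ → Ω → Fin d → ℝ}
    (hc : ∀ i, 0 < c i ∧ c i < 1) (hh : ∀ i, 0 < h i ∧ h i < 1)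
    (hS : ∀ t ω i, 0 < S t ω i) (hN : ∀ ω i, 0 ≤ N₀ ω i) (hW : ∀ ω, 0 < N₀ ω ⬝ᵥ S 0 ω)
    (hπ : ∀ t ω, π t ω ∈ stdSimplex ℝ (Fin d)) (t : ℕ) (ω : Ω) :
    (∀ i, 0 ≤ preHoldings c h N₀ S π t ω i) ∧ 0 < wealthPre c h N₀ S π t ω ∧
      drift (preHoldings c h N₀ S π (t + 1) ω) (S t ω) = π t ω ∧
      preHoldings c h N₀ S π (t + 1) ω ⬝ᵥ S t ω = wealthPre c h N₀ S π t ω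
        - cost c h ((preHoldings c h N₀ S π (t + 1) ω - preHoldings c h N₀ S π t ω) * S t ω) := by
  have step : ∀ t, (∀ i, 0 ≤ preHoldings c h N₀ S π t ω i) → 0 < wealthPre c h N₀ S π t ω →
      0 < wealthPre c h N₀ S π t ω *
          decay c h (drift (preHoldings c h N₀ S π t ω) (S t ω)) (π t ω) ∧
        ∀ i, preHoldings c h N₀ S π (t + 1) ω i * S t ω i = wealthPre c h N₀ S π t ω *
          decay c h (drift (preHoldings c h N₀ S π t ω) (S t ω)) (π t ω) * π t ω i := by
    intro t h1 h2
    have hs := decay_spec hc hh (drift_mem h1 (hS t ω) h2) (hπ t ω)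
    refine ⟨mul_pos h2 hs.1.1, fun i => ?_⟩
    simp only [preHoldings, wealthPre]
    exact div_mul_cancel₀ _ (hS t ω i).ne'
  have pos : ∀ t, (∀ i, 0 ≤ preHoldings c h N₀ S π t ω i) ∧ 0 < wealthPre c h N₀ S π t ω := by
    intro t
    induction t with
    | zero => exact ⟨hN ω, hW ω⟩
    | succ t ih =>
      obtain ⟨hp, he⟩ := step t ih.1 ih.2
      have hn : ∀ i, 0 ≤ preHoldings c h N₀ S π (t + 1) ω i := by
        intro i
        have := mul_nonneg hp.le ((hπ t ω).1 i)
        rw [← he i] at this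
        exact nonneg_of_mul_nonneg_left this (hS t ω i)
      refine ⟨hn, ?_⟩
      obtain ⟨i, hi⟩ : ∃ i, 0 < π t ω i := by
        by_contra! hcon
        have h0 : ∑ i, π t ω i ≤ 0 := Finset.sum_nonpos fun i _ => hcon i
        have h1 : ∑ i, π t ω i = 1 := (hπ t ω).2
        linarith
      have hi' : 0 < preHoldings c h N₀ S π (t + 1) ω i := by
        have := mul_pos hp hi
        rw [← he i] at this
        exact pos_of_mul_pos_left this (hS t ω i).le
      exact Finset.sum_pos' (fun j _ => mul_nonneg (hn j) (hS (t + 1) ω j).le)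
        ⟨i, Finset.mem_univ i, mul_pos hi' (hS (t + 1) ω i)⟩
  obtain ⟨h1, h2⟩ := pos t
  obtain ⟨hp, he⟩ := step t h1 h2
  have hs := (decay_spec hc hh (drift_mem h1 (hS t ω) h2) (hπ t ω)).2
  set x := drift (preHoldings c h N₀ S π t ω) (S t ω) with hx
  set W := wealthPre c h N₀ S π t ω with hWdef
  have hsum : preHoldings c h N₀ S π (t + 1) ω ⬝ᵥ S t ω = W * decay c h x (π t ω) := by
    simp only [dotProduct, he]
    rw [← Finset.mul_sum, (hπ t ω).2, mul_one]
  refine ⟨h1, h2, ?_, ?_⟩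
  · funext i
    simp only [drift]
    rw [hsum, he i]
    exact mul_div_cancel_left₀ _ hp.ne'
  · have hvec : (preHoldings c h N₀ S π (t + 1) ω - preHoldings c h N₀ S π t ω) * S t ω
        = W • (decay c h x (π t ω) • π t ω - x) := by
      funext i
      have hxi : W * x i = preHoldings c h N₀ S π t ω i * S t ω i := by
        rw [hx]
        exact mul_div_cancel₀ _ h2.ne'
      simp only [Pi.mul_apply, Pi.sub_apply, Pi.smul_apply, smul_eq_mul, sub_mul, mul_sub]
      rw [he i, hxi]
      ring
    rw [hsum, hvec, cost_smul h2.le]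
    linear_combination W * hs

end

end RiskSensitive

/-!
The proof works with exponentials. Multiplying the Bellman equation by `γ` turns it into the
eigenvalue problem `L v = v + l` for the operator
`(L v) x = max_y (γ * log (s(x, y)) + log E[⟨y, w⟩ ^ γ * exp (v (G(y, w)))])`
on the continuous functions on the simplex.

*Solution of the Bellman equation.* The operator `L` is monotone and commutes with the addition of
constants, so it is nonexpansive. As the cost is subadditive, `s(z, x) * s(x, y) ≤ s(z, y)`
(`decay_mul_decay_le`), and therefore `L v x - L v z ≤ -γ * log (s(z, x))` for every `v`. Thus all
functions `L v` share one modulus of continuity, and no ergodicity of the price process is needed.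
By the contraction principle `V = L (a • V)` is solvable for `a < 1`; after normalisation these
solutions are precompact by the Arzelà–Ascoli theorem, and a limit point as `a → 1` solves
`L v = v + l` (`exists_additive_eigenfunction`). A Borel selector of the maximisers exists by
`exists_measurable_selection`.

*Verification.* The vector `w(t+1)` is independent of the past and distributed like `w(1)`, so
`M(t) = W(t-) ^ γ * exp (v (π(t-)))` satisfies `E[M(t+1)] ≤ exp l * E[M(t)]` for every strategy,
with equality for the selectors of the Bellman equation (`weightedMoment_succ`). Since `v` is bounded,
`E[W(n-) ^ γ]` is within a constant factor of `E[M(n)]`, hence `J(π) ≤ l / γ` with equality for the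
selectors (`objective_le`, `le_objective`).
-/

namespace RiskSensitive

open Topology BoundedContinuousFunction

/-! ### Measurable selection on compact spaces -/

/-- **Measurable selection.** A closed relation between compact metric spaces, all of whose sections
are nonempty, contains the graph of a Borel map: parametrise the second space by the Cantor set and pick the
least parameter in each section. -/
theorem exists_measurable_selection {X Y : Type*} [MetricSpace X] [CompactSpace X]
    [MeasurableSpace X] [BorelSpace X] [MetricSpace Y] [CompactSpace Y] [Nonempty Y]
    [MeasurableSpace Y] [BorelSpace Y] {R : Set (X × Y)} (hR : IsClosed R)
    (hne : ∀ x, ∃ y, (x, y) ∈ R) : ∃ u : X → Y, Measurable u ∧ ∀ x, (x, u x) ∈ R := by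
  obtain ⟨f₀, hf₀, hf₀s⟩ := exists_nat_bool_continuous_surjective_of_compact Y
  have hcK : CompactSpace cantorSet := isCompact_iff_compactSpace.mp isCompact_cantorSet
  -- `Y` is a continuous image of the Cantor set, which is a compact subset of the line
  let f : cantorSet → Y := f₀ ∘ cantorSetHomeomorphNatToBool
  have hf : Continuous f := hf₀.comp cantorSetHomeomorphNatToBool.continuous
  have hfs : Function.Surjective f := hf₀s.comp cantorSetHomeomorphNatToBool.surjective
  have hR' : IsClosed {p : X × cantorSet | (p.1, f p.2) ∈ R} :=
    hR.preimage (continuous_fst.prodMk (hf.comp continuous_snd))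
  have hmin : ∀ x, ∃ t : cantorSet, (x, f t) ∈ R ∧ ∀ t', (x, f t') ∈ R → t ≤ t' := by
    intro x
    have hc : IsCompact {t : cantorSet | (x, f t) ∈ R} :=
      (hR'.preimage (continuous_const.prodMk continuous_id)).isCompact
    obtain ⟨y, hy⟩ := hne x
    obtain ⟨t, rfl⟩ := hfs y
    obtain ⟨m, hm⟩ := hc.exists_isLeast ⟨t, hy⟩
    exact ⟨m, hm.1, fun t' ht' => hm.2 ht'⟩
  choose τ hτ hτmin using hmin
  have hτmeas : Measurable τ := by
    suffices h : Measurable fun x => (τ x : ℝ) from h.subtype_mk (h := fun x => (τ x).2)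
    refine measurable_of_Iic fun a => IsClosed.measurableSet ?_
    -- the least element of the section is at most `a` iff the section meets `(-∞, a]`
    have : (fun x => (τ x : ℝ)) ⁻¹' Set.Iic a =
        Prod.fst '' ({p : X × cantorSet | (p.1, f p.2) ∈ R} ∩ {p | (p.2 : ℝ) ≤ a}) := by
      ext x
      constructor
      · intro hx
        exact ⟨(x, τ x), ⟨hτ x, hx⟩, rfl⟩
      · rintro ⟨⟨x', t⟩, ⟨h1, h2⟩, rfl⟩
        exact le_trans (Subtype.coe_le_coe.2 (hτmin _ t h1)) h2
    rw [this]
    exact ((hR'.inter (isClosed_le (by fun_prop) continuous_const)).isCompact.image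
      continuous_fst).isClosed
  exact ⟨fun x => f (τ x), hf.measurable.comp hτmeas, hτ⟩

/-! ### The additive eigenvalue problem -/

/-- **Additive eigenvalue problem.** Let `L` be a monotone operator on the continuous functions of a
compact space that commutes with the addition of constants, and suppose that all functions `L V`
have a common modulus of continuity. Then `L v = v + l` has a solution. The proof is by vanishing
discount: for `a < 1` the map `V ↦ L (a • V)` is a contraction, and its fixed points, normalised to
vanish at a point, accumulate at a solution as `a → 1`. -/
theorem exists_additive_eigenfunction {X : Type*} [TopologicalSpace X] [CompactSpace X] [Nonempty X]
    (L : (X →ᵇ ℝ) → (X →ᵇ ℝ))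
    (hL : ∀ V W : X →ᵇ ℝ, ∀ k : ℝ, (∀ x, V x ≤ W x + k) → ∀ x, L V x ≤ L W x + k)
    (ρ : X × X → ℝ) (hρ : Continuous ρ) (hρ0 : ∀ x, ρ (x, x) = 0)
    (hLρ : ∀ V x z, L V x - L V z ≤ ρ (x, z)) :
    ∃ (l : ℝ) (v : X →ᵇ ℝ), ∀ x, L v x = v x + l := by
  obtain ⟨x₀⟩ := ‹Nonempty X›
  have hdist : ∀ V W : X →ᵇ ℝ, dist (L V) (L W) ≤ dist V W := by
    intro V W
    refine (dist_le dist_nonneg).2 fun x => ?_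
    rw [Real.dist_eq, abs_sub_le_iff]
    have h1 := hL V W (dist V W) (fun y => by
      have :=
        (abs_sub_le_iff.1 ((Real.dist_eq _ _).symm.trans_le (dist_coe_le_dist (f := V) (g := W) y))).1
      linarith) x
    have h2 := hL W V (dist V W) (fun y => by
      have :=
        (abs_sub_le_iff.1 ((Real.dist_eq _ _).symm.trans_le (dist_coe_le_dist (f := V) (g := W) y))).2
      linarith) x
    constructor <;> linarith
  have hLcont : Continuous L := (LipschitzWith.mk_one hdist).continuous
  have hconst : ∀ (V W : X →ᵇ ℝ) (k : ℝ), (∀ x, V x = W x + k) → ∀ x, L V x = L W x + k := by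
    intro V W k hVW x
    refine le_antisymm (hL V W k (fun y => (hVW y).le) x) ?_
    have := hL W V (-k) (fun y => by linarith [hVW y]) x
    linarith
  -- the discounted equation is solved by the contraction principle
  have hfix : ∀ a : NNReal, a < 1 → ∃ V : X →ᵇ ℝ, L ((a : ℝ) • V) = V := by
    intro a ha
    have hc : ContractingWith a fun V : X →ᵇ ℝ => L ((a : ℝ) • V) := by
      refine ⟨ha, LipschitzWith.of_dist_le_mul fun V W => (hdist _ _).trans ?_⟩
      refine (dist_le (by positivity)).2 fun x => ?_
      rw [coe_smul, coe_smul, dist_smul₀, Real.norm_of_nonneg a.coe_nonneg]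
      exact mul_le_mul_of_nonneg_left (dist_coe_le_dist x) a.2
    exact ⟨_, hc.fixedPoint_isFixedPt⟩
  let a : ℕ → NNReal := fun n => 1 - 1 / ((n : NNReal) + 1)
  have ha1 : ∀ n, a n < 1 := fun n => tsub_lt_self one_pos (by positivity)
  have hareal : ∀ n, (a n : ℝ) = 1 - 1 / ((n : ℝ) + 1) := by
    intro n
    have : (1 : NNReal) / ((n : NNReal) + 1) ≤ 1 := by
      rw [div_le_one (by positivity)]
      exact le_add_self
    simp only [a]
    rw [NNReal.coe_sub this]
    simp
  choose V hV using fun n => hfix (a n) (ha1 n)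
  let U : ℕ → X →ᵇ ℝ := fun n => V n - const X (V n x₀)
  -- the normalised solution satisfies `U = L (a • U) - (1 - a) * V x₀`; at `x₀` this makes the
  -- constants `(1 - a) * V x₀` converge along with the functions `U`
  have hU : ∀ n x, U n x = L ((a n : ℝ) • U n) x - (1 - a n) * V n x₀ := by
    intro n x
    have h1 := hconst ((a n : ℝ) • V n) ((a n : ℝ) • U n) (a n * V n x₀) (fun y => by
      simp [U]; ring) x
    rw [hV n] at h1
    simp only [U, coe_sub, Pi.sub_apply, const_apply] at h1 ⊢
    linarith
  obtain ⟨C, hC⟩ : ∃ C, ∀ p, |ρ p| ≤ C := by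
    obtain ⟨C, hC⟩ := (isCompact_range hρ).isBounded.exists_norm_le
    exact ⟨C, fun p => hC _ ⟨p, rfl⟩⟩
  let A : Set (X →ᵇ ℝ) := {f | f x₀ = 0 ∧ ∀ x z, f x - f z ≤ ρ (x, z)}
  have hUA : ∀ n, U n ∈ A := by
    intro n
    refine ⟨by simp [U], fun x z => ?_⟩
    have := hLρ ((a n : ℝ) • V n) x z
    rw [hV n] at this
    simpa [U] using this
  have hAcomp : IsCompact (closure A) := by
    refine arzela_ascoli (Set.Icc (-C) C) isCompact_Icc A ?_ ?_
    · intro f x hf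
      have h1 := hf.2 x x₀
      have h2 := hf.2 x₀ x
      rw [hf.1] at h1 h2
      constructor
      · linarith [(abs_le.1 (hC (x₀, x))).2]
      · linarith [(abs_le.1 (hC (x, x₀))).2]
    · intro x
      rw [Metric.equicontinuousAt_iff_right]
      intro ε hε
      have h1 : Tendsto (fun z => ρ (x, z)) (𝓝 x) (𝓝 0) := by
        rw [← hρ0 x]
        exact (hρ.comp (continuous_const.prodMk continuous_id)).continuousAt
      have h2 : Tendsto (fun z => ρ (z, x)) (𝓝 x) (𝓝 0) := by
        rw [← hρ0 x]
        exact (hρ.comp (continuous_id.prodMk continuous_const)).continuousAt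
      filter_upwards [h1.eventually (gt_mem_nhds hε), h2.eventually (gt_mem_nhds hε)]
        with z hz1 hz2 f
      rw [Real.dist_eq, abs_lt]
      have := f.2.2 x z
      have := f.2.2 z x
      constructor <;> linarith
  obtain ⟨v, -, φ, hφ, hlim⟩ := hAcomp.tendsto_subseq fun n => subset_closure (hUA n)
  have halim : Tendsto (fun n => (a (φ n) : ℝ)) atTop (𝓝 1) := by
    refine Tendsto.comp (g := fun n => (a n : ℝ)) ?_ hφ.tendsto_atTop
    simp only [hareal]
    simpa using tendsto_one_div_add_atTop_nhds_zero_nat.const_sub (1 : ℝ)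
  have hLlim : Tendsto (fun n => L ((a (φ n) : ℝ) • U (φ n))) atTop (𝓝 (L v)) := by
    have := halim.smul hlim
    rw [one_smul] at this
    exact (hLcont.tendsto v).comp this
  have hev : ∀ x, Continuous fun f : X →ᵇ ℝ => f x := fun x => continuous_eval_const x
  have hm : Tendsto (fun n => (1 - (a (φ n) : ℝ)) * V (φ n) x₀) atTop (𝓝 (L v x₀)) := by
    refine (((hev x₀).tendsto _).comp hLlim).congr fun n => ?_
    have := hU (φ n) x₀
    rw [(hUA _).1] at this
    simp only [Function.comp]
    linarith
  refine ⟨L v x₀, v, fun x => ?_⟩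
  have h1 : Tendsto (fun n => U (φ n) x) atTop (𝓝 (v x)) := ((hev x).tendsto _).comp hlim
  have h2 : Tendsto (fun n => U (φ n) x) atTop (𝓝 (L v x - L v x₀)) :=
    ((((hev x).tendsto _).comp hLlim).sub hm).congr fun n => (hU (φ n) x).symm
  linarith [tendsto_nhds_unique h1 h2]

/-! ### The capital decay -/

section Decay

variable {d : ℕ} {c h : Fin d → ℝ}

theorem cost_add_le (hc : ∀ i, 0 < c i ∧ c i < 1) (hh : ∀ i, 0 < h i ∧ h i < 1)
    (x y : Fin d → ℝ) : cost c h (x + y) ≤ cost c h x + cost c h y := by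
  rw [cost_eq, cost_eq, cost_eq, ← Finset.sum_add_distrib]
  refine Finset.sum_le_sum fun i _ => ?_
  have h1 : max (x i + y i) 0 ≤ max (x i) 0 + max (y i) 0 :=
    max_le (add_le_add (le_max_left _ _) (le_max_left _ _))
      (add_nonneg (le_max_right _ _) (le_max_right _ _))
  have h2 : max (-(x i + y i)) 0 ≤ max (-x i) 0 + max (-y i) 0 := by
    refine max_le ?_ (add_nonneg (le_max_right _ _) (le_max_right _ _))
    rw [neg_add]
    exact add_le_add (le_max_left _ _) (le_max_left _ _)
  have h3 := mul_le_mul_of_nonneg_left h1 (hc i).1.le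
  have h4 := mul_le_mul_of_nonneg_left h2 (hh i).1.le
  simp only [Pi.add_apply]
  linarith

theorem decay_self (hc : ∀ i, 0 < c i ∧ c i < 1) (hh : ∀ i, 0 < h i ∧ h i < 1)
    {x : Fin d → ℝ} (hx : x ∈ stdSimplex ℝ (Fin d)) : decay c h x x = 1 := by
  refine (strictMono_rebalance hc hh hx).injective ((decay_spec hc hh hx hx).2.trans ?_)
  simp [cost]

/-- Rebalancing directly is at least as good as rebalancing through intermediate weights, because
the cost is subadditive. -/
theorem decay_mul_decay_le (hc : ∀ i, 0 < c i ∧ c i < 1) (hh : ∀ i, 0 < h i ∧ h i < 1)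
    {x z y : Fin d → ℝ} (hx : x ∈ stdSimplex ℝ (Fin d)) (hz : z ∈ stdSimplex ℝ (Fin d))
    (hy : y ∈ stdSimplex ℝ (Fin d)) : decay c h x z * decay c h z y ≤ decay c h x y := by
  obtain ⟨⟨ha, -⟩, ha'⟩ := decay_spec hc hh hx hz
  obtain ⟨-, hb'⟩ := decay_spec hc hh hz hy
  refine (strictMono_rebalance hc hh hy (x := x)).le_iff_le.1 ?_
  rw [(decay_spec hc hh hx hy).2]
  set a := decay c h x z
  set b := decay c h z y
  have e : (a * b) • y - x = a • (b • y - z) + (a • z - x) := by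
    rw [smul_sub, smul_smul]
    abel
  have h1 := cost_add_le hc hh (a • (b • y - z)) (a • z - x)
  rw [← e, cost_smul ha.le] at h1
  have h2 : a * b + a * cost c h (b • y - z) = a := by rw [← mul_add, hb', mul_one]
  linarith

theorem continuous_cost : Continuous (cost c h) := by
  have e : cost c h = fun x => ∑ i, (c i * max (x i) 0 + h i * max (-x i) 0) :=
    funext (cost_eq c h)
  rw [e]
  fun_prop

theorem continuous_decay (hc : ∀ i, 0 < c i ∧ c i < 1) (hh : ∀ i, 0 < h i ∧ h i < 1) :
    Continuous fun p : stdSimplex ℝ (Fin d) × stdSimplex ℝ (Fin d) =>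
      decay c h p.1.1 p.2.1 := by
  have hF : ∀ a : ℝ, Continuous fun p : stdSimplex ℝ (Fin d) × stdSimplex ℝ (Fin d) =>
      a + cost c h (a • p.2.1 - p.1.1) := by
    intro a
    exact continuous_const.add (continuous_cost.comp
      (((continuous_subtype_val.comp continuous_snd).const_smul a).sub
        (continuous_subtype_val.comp continuous_fst)))
  rw [continuous_iff_continuousAt]
  intro p
  refine tendsto_order.2 ⟨fun a ha => ?_, fun a ha => ?_⟩
  -- the left side of the defining equation increases strictly, so comparing the root with `a` is
  -- comparing the left side at `a` with `1`, and that is an open condition on the weights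
  · have h1 := strictMono_rebalance hc hh p.2.2 (x := p.1.1) ha
    simp only [(decay_spec hc hh p.1.2 p.2.2).2] at h1
    filter_upwards [(hF a).continuousAt.eventually (gt_mem_nhds h1)] with q hq
    refine (strictMono_rebalance hc hh q.2.2 (x := q.1.1)).lt_iff_lt.1 ?_
    simpa only [(decay_spec hc hh q.1.2 q.2.2).2] using hq
  · have h1 := strictMono_rebalance hc hh p.2.2 (x := p.1.1) ha
    simp only [(decay_spec hc hh p.1.2 p.2.2).2] at h1
    filter_upwards [(hF a).continuousAt.eventually (lt_mem_nhds h1)] with q hq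
    refine (strictMono_rebalance hc hh q.2.2 (x := q.1.1)).lt_iff_lt.1 ?_
    simpa only [(decay_spec hc hh q.1.2 q.2.2).2] using hq

end Decay

/-! ### The expected growth of one period -/

section Gain

variable {Ω : Type*} [MeasurableSpace Ω] {d : ℕ}

theorem dotProduct_pos_of_mem_stdSimplex {y w : Fin d → ℝ} (hy : y ∈ stdSimplex ℝ (Fin d))
    (hw : ∀ i, 0 < w i) : 0 < y ⬝ᵥ w := by
  obtain ⟨i, hi⟩ : ∃ i, 0 < y i := by
    by_contra! hcon
    have h0 : ∑ i, y i ≤ 0 := Finset.sum_nonpos fun i _ => hcon i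
    have h1 : ∑ i, y i = 1 := hy.2
    linarith
  exact Finset.sum_pos' (fun j _ => mul_nonneg (hy.1 j) (hw j).le)
    ⟨i, Finset.mem_univ i, mul_pos hi (hw i)⟩

theorem drift_mem_of_mem {y w : Fin d → ℝ} (hy : y ∈ stdSimplex ℝ (Fin d))
    (hw : ∀ i, 0 < w i) : drift y w ∈ stdSimplex ℝ (Fin d) :=
  drift_mem hy.1 hw (dotProduct_pos_of_mem_stdSimplex hy hw)

theorem dotProduct_rpow_le_sum {γ : ℝ} (hγ : 0 < γ) {y w : Fin d → ℝ}
    (hy : y ∈ stdSimplex ℝ (Fin d)) (hw : ∀ i, 0 < w i) :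
    (y ⬝ᵥ w) ^ γ ≤ ∑ i, w i ^ γ := by
  have hne : (Finset.univ : Finset (Fin d)).Nonempty := by
    by_contra hcon
    have h1 : ∑ i, y i = 1 := hy.2
    rw [Finset.not_nonempty_iff_eq_empty.1 hcon] at h1
    simp at h1
  obtain ⟨i, -, hi⟩ := Finset.exists_max_image Finset.univ w hne
  have h1 : y ⬝ᵥ w ≤ w i := by
    calc y ⬝ᵥ w ≤ ∑ j, y j * w i :=
          Finset.sum_le_sum fun j hj => mul_le_mul_of_nonneg_left (hi j hj) (hy.1 j)
      _ = w i := by rw [← Finset.sum_mul, hy.2, one_mul]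
  refine (Real.rpow_le_rpow (dotProduct_pos_of_mem_stdSimplex hy hw).le h1 hγ.le).trans ?_
  exact Finset.single_le_sum (f := fun j => w j ^ γ)
    (fun j _ => Real.rpow_nonneg (hw j).le γ) (Finset.mem_univ i)

theorem measurable_drift : Measurable fun p : (Fin d → ℝ) × (Fin d → ℝ) => drift p.1 p.2 := by
  unfold drift dotProduct
  fun_prop

/-- The growth factor `⟨y, w⟩ ^ γ * exp (v (G(y, w)))` of one period in which the weights `y` are
held and the relative price shift is `w`. -/
noncomputable def gain (γ : ℝ) (v : (Fin d → ℝ) → ℝ) (y w : Fin d → ℝ) : ℝ :=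
  (y ⬝ᵥ w) ^ γ * Real.exp (v (drift y w))

theorem measurable_gain {γ : ℝ} {v : (Fin d → ℝ) → ℝ} (hv : Measurable v) :
    Measurable fun p : (Fin d → ℝ) × (Fin d → ℝ) => gain γ v p.1 p.2 := by
  have h1 : Measurable fun p : (Fin d → ℝ) × (Fin d → ℝ) => p.1 ⬝ᵥ p.2 := by
    unfold dotProduct
    fun_prop
  exact (h1.pow_const γ).mul (hv.comp measurable_drift).exp

theorem gain_pos {γ : ℝ} {v : (Fin d → ℝ) → ℝ} {y w : Fin d → ℝ} (hy : y ∈ stdSimplex ℝ (Fin d))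
    (hw : ∀ i, 0 < w i) : 0 < gain γ v y w :=
  mul_pos (Real.rpow_pos_of_pos (dotProduct_pos_of_mem_stdSimplex hy hw) γ) (Real.exp_pos _)

theorem gain_le {γ : ℝ} (hγ : 0 < γ) {v : (Fin d → ℝ) → ℝ} {C : ℝ}
    (hC : ∀ x ∈ stdSimplex ℝ (Fin d), v x ≤ C) {y w : Fin d → ℝ}
    (hy : y ∈ stdSimplex ℝ (Fin d)) (hw : ∀ i, 0 < w i) :
    gain γ v y w ≤ (∑ i, w i ^ γ) * Real.exp C :=
  mul_le_mul (dotProduct_rpow_le_sum hγ hy hw)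
    (Real.exp_le_exp.2 (hC _ (drift_mem_of_mem hy hw))) (Real.exp_pos _).le
    (Finset.sum_nonneg fun i _ => Real.rpow_nonneg (hw i).le γ)

theorem integrable_gain (P : Measure Ω) {γ : ℝ} (hγ : 0 < γ)
    {w : Ω → Fin d → ℝ} (hwm : Measurable w) (hw : ∀ ω i, 0 < w ω i)
    (hwi : ∀ i, Integrable (fun ω => w ω i ^ γ) P) {v : (Fin d → ℝ) → ℝ} (hv : Measurable v)
    {C : ℝ} (hC : ∀ x ∈ stdSimplex ℝ (Fin d), v x ≤ C) {y : Fin d → ℝ}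
    (hy : y ∈ stdSimplex ℝ (Fin d)) : Integrable (fun ω => gain γ v y (w ω)) P := by
  refine ((integrable_finsetSum Finset.univ fun i _ => hwi i).mul_const (Real.exp C)).mono' ?_ ?_
  · exact ((measurable_gain hv).comp (measurable_const.prodMk hwm)).aestronglyMeasurable
  · refine Eventually.of_forall fun ω => ?_
    rw [Real.norm_of_nonneg (gain_pos hy (hw ω)).le]
    exact gain_le hγ hC hy (hw ω)

theorem integral_gain_pos (P : Measure Ω) [IsProbabilityMeasure P] {γ : ℝ} (hγ : 0 < γ)
    {w : Ω → Fin d → ℝ} (hwm : Measurable w) (hw : ∀ ω i, 0 < w ω i)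
    (hwi : ∀ i, Integrable (fun ω => w ω i ^ γ) P) {v : (Fin d → ℝ) → ℝ} (hv : Measurable v)
    {C : ℝ} (hC : ∀ x ∈ stdSimplex ℝ (Fin d), v x ≤ C) {y : Fin d → ℝ}
    (hy : y ∈ stdSimplex ℝ (Fin d)) : 0 < ∫ ω, gain γ v y (w ω) ∂P := by
  rw [integral_pos_iff_support_of_nonneg (fun ω => (gain_pos hy (hw ω)).le)
    (integrable_gain P hγ hwm hw hwi hv hC hy)]
  have : Function.support (fun ω => gain γ v y (w ω)) = Set.univ :=
    Set.eq_univ_of_forall fun ω => (gain_pos hy (hw ω)).ne'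
  simp [this]

/-- The extension by zero of a function on the simplex. -/
noncomputable def extendSimplex (V : stdSimplex ℝ (Fin d) → ℝ) : (Fin d → ℝ) → ℝ :=
  Function.extend Subtype.val V 0

theorem extendSimplex_coe (V : stdSimplex ℝ (Fin d) → ℝ) (x : stdSimplex ℝ (Fin d)) :
    extendSimplex V x.1 = V x :=
  Subtype.val_injective.extend_apply V 0 x

theorem extendSimplex_of_mem (V : stdSimplex ℝ (Fin d) → ℝ) {x : Fin d → ℝ}
    (hx : x ∈ stdSimplex ℝ (Fin d)) : extendSimplex V x = V ⟨x, hx⟩ :=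
  extendSimplex_coe V ⟨x, hx⟩

theorem measurable_extendSimplex {V : stdSimplex ℝ (Fin d) → ℝ} (hV : Measurable V) :
    Measurable (extendSimplex V) :=
  (MeasurableEmbedding.subtype_coe (isClosed_stdSimplex ℝ (Fin d)).measurableSet).measurable_extend
    hV measurable_const

/-- Continuity by dominated convergence, with dominating function `(∑ i, w i ^ γ) * exp ‖V‖`. -/
theorem continuous_integral_gain (P : Measure Ω) {γ : ℝ} (hγ : 0 < γ)
    {w : Ω → Fin d → ℝ} (hwm : Measurable w) (hw : ∀ ω i, 0 < w ω i)
    (hwi : ∀ i, Integrable (fun ω => w ω i ^ γ) P) (V : stdSimplex ℝ (Fin d) →ᵇ ℝ) :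
    Continuous fun y : stdSimplex ℝ (Fin d) => ∫ ω, gain γ (extendSimplex V) y.1 (w ω) ∂P := by
  have hC : ∀ x ∈ stdSimplex ℝ (Fin d), extendSimplex V x ≤ ‖V‖ := fun x hx => by
    rw [extendSimplex_of_mem _ hx]
    exact (le_abs_self _).trans (V.norm_coe_le_norm _)
  refine continuous_of_dominated (bound := fun ω => (∑ i, w ω i ^ γ) * Real.exp ‖V‖) ?_ ?_ ?_ ?_
  · intro y
    exact ((measurable_gain (measurable_extendSimplex V.continuous.measurable)).comp
      (measurable_const.prodMk hwm)).aestronglyMeasurable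
  · intro y
    refine Eventually.of_forall fun ω => ?_
    rw [Real.norm_of_nonneg (gain_pos y.2 (hw ω)).le]
    exact gain_le hγ hC y.2 (hw ω)
  · exact (integrable_finsetSum Finset.univ fun i _ => hwi i).mul_const _
  · refine Eventually.of_forall fun ω => ?_
    have e : (fun y : stdSimplex ℝ (Fin d) => gain γ (extendSimplex V) y.1 (w ω)) = fun y =>
        (y.1 ⬝ᵥ w ω) ^ γ *
          Real.exp (V ⟨drift y.1 (w ω), drift_mem_of_mem y.2 (hw ω)⟩) := by
      funext y
      rw [gain, extendSimplex_of_mem _ (drift_mem_of_mem y.2 (hw ω))]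
    have hdot : Continuous fun y : stdSimplex ℝ (Fin d) => y.1 ⬝ᵥ w ω := by
      have : Continuous fun y : Fin d → ℝ => y ⬝ᵥ w ω := by
        unfold dotProduct
        fun_prop
      exact this.comp continuous_subtype_val
    have hdrift : Continuous fun y : stdSimplex ℝ (Fin d) => drift y.1 (w ω) := by
      refine continuous_pi fun i => Continuous.div ?_ hdot fun y => ?_
      · exact ((continuous_apply i).comp continuous_subtype_val).mul continuous_const
      · exact (dotProduct_pos_of_mem_stdSimplex y.2 (hw ω)).ne'
    rw [e]
    exact (hdot.rpow_const fun y => Or.inr hγ.le).mul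
      (Real.continuous_exp.comp (V.continuous.comp (hdrift.subtype_mk _)))

end Gain

/-! ### The Bellman equation -/

section Bellman

variable {Ω : Type*} [MeasurableSpace Ω] {d : ℕ}

/-- The logarithm of `E[s(x, y) ^ γ * ⟨y, w⟩ ^ γ * exp (v (G(y, w)))]`, which is `γ` times the
expression maximised in the Bellman equation. -/
noncomputable def logReward (P : Measure Ω) (γ : ℝ) (c h : Fin d → ℝ) (w : Ω → Fin d → ℝ)
    (v : (Fin d → ℝ) → ℝ) (x y : Fin d → ℝ) : ℝ :=
  γ * Real.log (decay c h x y) + Real.log (∫ ω, gain γ v y (w ω) ∂P)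

theorem bellmanTerm_eq_logReward (P : Measure Ω) [IsProbabilityMeasure P] {γ : ℝ} (hγ : 0 < γ)
    {c h : Fin d → ℝ} (hc : ∀ i, 0 < c i ∧ c i < 1) (hh : ∀ i, 0 < h i ∧ h i < 1)
    {w : Ω → Fin d → ℝ} (hwm : Measurable w) (hw : ∀ ω i, 0 < w ω i)
    (hwi : ∀ i, Integrable (fun ω => w ω i ^ γ) P) {v : (Fin d → ℝ) → ℝ} (hv : Measurable v)
    {C : ℝ} (hC : ∀ x ∈ stdSimplex ℝ (Fin d), v x ≤ C) {x y : Fin d → ℝ}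
    (hx : x ∈ stdSimplex ℝ (Fin d)) (hy : y ∈ stdSimplex ℝ (Fin d)) :
    bellmanTerm P γ c h w v x y = ((1 / γ * logReward P γ c h w v x y : ℝ) : EReal) := by
  have hs := (decay_spec hc hh hx hy).1.1
  have hI := integral_gain_pos P hγ hwm hw hwi hv hC hy
  have e : ∀ ω, Real.exp (γ * (Real.log (y ⬝ᵥ w ω) + Real.log (decay c h x y)
      + γ⁻¹ * v (drift y (w ω)))) = decay c h x y ^ γ * gain γ v y (w ω) := by
    intro ω
    rw [gain, Real.rpow_def_of_pos hs,
      Real.rpow_def_of_pos (dotProduct_pos_of_mem_stdSimplex hy (hw ω)), ← Real.exp_add,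
      ← Real.exp_add]
    congr 1
    field_simp
    ring
  have hpos : 0 < decay c h x y ^ γ * ∫ ω, gain γ v y (w ω) ∂P :=
    mul_pos (Real.rpow_pos_of_pos hs γ) hI
  have e2 : Real.log (decay c h x y ^ γ * ∫ ω, gain γ v y (w ω) ∂P)
      = logReward P γ c h w v x y := by
    rw [Real.log_mul (Real.rpow_pos_of_pos hs γ).ne' hI.ne', Real.log_rpow hs, logReward]
  unfold bellmanTerm entropic
  simp only [e]
  rw [← ofReal_integral_eq_lintegral_ofReal
    ((integrable_gain P hγ hwm hw hwi hv hC hy).const_mul _)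
    (Eventually.of_forall fun ω =>
      (mul_pos (Real.rpow_pos_of_pos hs γ) (gain_pos hy (hw ω))).le),
    integral_const_mul, ENNReal.log_ofReal_of_pos hpos, e2, EReal.coe_mul]

theorem exists_maximum_function {X : Type*} [TopologicalSpace X] [CompactSpace X] [Nonempty X]
    {K : X → X → ℝ} (hK : Continuous fun p : X × X => K p.1 p.2) :
    ∃ m : X →ᵇ ℝ, (∀ x y, K x y ≤ m x) ∧ ∀ x, ∃ y, K x y = m x := by
  have hc : Continuous fun x => sSup (K x '' Set.univ) := isCompact_univ.continuous_sSup hK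
  have hKx : ∀ x, Continuous (K x) := fun x => hK.comp (continuous_const.prodMk continuous_id)
  refine ⟨mkOfCompact ⟨_, hc⟩, fun x y => ?_, fun x => ?_⟩
  · exact le_csSup (isCompact_univ.image (hKx x)).bddAbove ⟨y, Set.mem_univ y, rfl⟩
  · obtain ⟨y, -, hy⟩ := (isCompact_univ.image (hKx x)).sSup_mem (Set.univ_nonempty.image _)
    exact ⟨y, hy⟩

theorem extendSimplex_le_norm (V : stdSimplex ℝ (Fin d) →ᵇ ℝ) :
    ∀ x ∈ stdSimplex ℝ (Fin d), extendSimplex V x ≤ ‖V‖ := fun x hx => by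
  rw [extendSimplex_of_mem _ hx]
  exact (le_abs_self _).trans (V.norm_coe_le_norm _)

/-- `logReward` is monotone in `v` and commutes with the addition of constants to `v`. -/
theorem logReward_le_add (P : Measure Ω) [IsProbabilityMeasure P] {γ : ℝ} (hγ : 0 < γ)
    {c h : Fin d → ℝ} {w : Ω → Fin d → ℝ} (hwm : Measurable w) (hw : ∀ ω i, 0 < w ω i)
    (hwi : ∀ i, Integrable (fun ω => w ω i ^ γ) P) {V W : stdSimplex ℝ (Fin d) →ᵇ ℝ} {k : ℝ}
    (hVW : ∀ x, V x ≤ W x + k) (x y : stdSimplex ℝ (Fin d)) :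
    logReward P γ c h w (extendSimplex V) x.1 y.1 ≤
      logReward P γ c h w (extendSimplex W) x.1 y.1 + k := by
  have hm : ∀ V : stdSimplex ℝ (Fin d) →ᵇ ℝ, Measurable (extendSimplex V) := fun V =>
    measurable_extendSimplex V.continuous.measurable
  have hpos : ∀ V : stdSimplex ℝ (Fin d) →ᵇ ℝ,
      0 < ∫ ω, gain γ (extendSimplex V) y.1 (w ω) ∂P := fun V =>
    integral_gain_pos P hγ hwm hw hwi (hm V) (extendSimplex_le_norm V) y.2
  have hint : ∀ V : stdSimplex ℝ (Fin d) →ᵇ ℝ,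
      Integrable (fun ω => gain γ (extendSimplex V) y.1 (w ω)) P := fun V =>
    integrable_gain P hγ hwm hw hwi (hm V) (extendSimplex_le_norm V) y.2
  have h1 : ∫ ω, gain γ (extendSimplex V) y.1 (w ω) ∂P ≤
      Real.exp k * ∫ ω, gain γ (extendSimplex W) y.1 (w ω) ∂P := by
    rw [← integral_const_mul]
    refine integral_mono (hint V) ((hint W).const_mul _) fun ω => ?_
    have hp := Real.rpow_pos_of_pos (dotProduct_pos_of_mem_stdSimplex y.2 (hw ω)) γ
    simp only [gain]
    rw [mul_left_comm, ← Real.exp_add]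
    refine mul_le_mul_of_nonneg_left (Real.exp_le_exp.2 ?_) hp.le
    rw [extendSimplex_of_mem _ (drift_mem_of_mem y.2 (hw ω)),
      extendSimplex_of_mem _ (drift_mem_of_mem y.2 (hw ω))]
    linarith [hVW ⟨_, drift_mem_of_mem y.2 (hw ω)⟩]
  have h2 := Real.log_le_log (hpos V) h1
  rw [Real.log_mul (Real.exp_pos k).ne' (hpos W).ne', Real.log_exp] at h2
  unfold logReward
  linarith

/-- The modulus of continuity of `logReward` in its first argument does not depend on `v`: starting
from the weights `z`, one may first rebalance to `x`. -/
theorem logReward_sub_le (P : Measure Ω) {γ : ℝ} (hγ : 0 < γ) {c h : Fin d → ℝ}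
    (hc : ∀ i, 0 < c i ∧ c i < 1) (hh : ∀ i, 0 < h i ∧ h i < 1) (w : Ω → Fin d → ℝ)
    (v : (Fin d → ℝ) → ℝ) {x y z : Fin d → ℝ} (hx : x ∈ stdSimplex ℝ (Fin d))
    (hy : y ∈ stdSimplex ℝ (Fin d)) (hz : z ∈ stdSimplex ℝ (Fin d)) :
    logReward P γ c h w v x y - logReward P γ c h w v z y ≤ -(γ * Real.log (decay c h z x)) := by
  have hs1 := (decay_spec hc hh hz hx).1.1
  have hs2 := (decay_spec hc hh hx hy).1.1
  have h2 := Real.log_le_log (mul_pos hs1 hs2) (decay_mul_decay_le hc hh hz hx hy)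
  rw [Real.log_mul hs1.ne' hs2.ne'] at h2
  have h3 := mul_le_mul_of_nonneg_left h2 hγ.le
  unfold logReward
  linarith

/-- The Bellman equation has a solution `V` with constant `l`: the function `x ↦ V x + l` is the
maximum over `y` of `logReward`. The Bellman operator is monotone and commutes with the addition of
constants by `logReward_le_add`, and its values have a common modulus of continuity by
`logReward_sub_le`. -/
theorem exists_bellman_solution (hd : 0 < d) (P : Measure Ω) [IsProbabilityMeasure P] {γ : ℝ}
    (hγ : 0 < γ) {c h : Fin d → ℝ} (hc : ∀ i, 0 < c i ∧ c i < 1) (hh : ∀ i, 0 < h i ∧ h i < 1)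
    {w : Ω → Fin d → ℝ} (hwm : Measurable w) (hw : ∀ ω i, 0 < w ω i)
    (hwi : ∀ i, Integrable (fun ω => w ω i ^ γ) P) :
    ∃ (l : ℝ) (V : stdSimplex ℝ (Fin d) →ᵇ ℝ),
      Continuous (fun p : stdSimplex ℝ (Fin d) × stdSimplex ℝ (Fin d) =>
        logReward P γ c h w (extendSimplex V) p.1.1 p.2.1) ∧
      ∀ x : stdSimplex ℝ (Fin d),
        (∀ y : stdSimplex ℝ (Fin d), logReward P γ c h w (extendSimplex V) x.1 y.1 ≤ V x + l) ∧
        ∃ y : stdSimplex ℝ (Fin d), logReward P γ c h w (extendSimplex V) x.1 y.1 = V x + l := by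
  have : Nonempty (Fin d) := ⟨⟨0, hd⟩⟩
  have hlogs : Continuous fun p : stdSimplex ℝ (Fin d) × stdSimplex ℝ (Fin d) =>
      γ * Real.log (decay c h p.1.1 p.2.1) :=
    continuous_const.mul ((continuous_decay hc hh).log fun p =>
      (decay_spec hc hh p.1.2 p.2.2).1.1.ne')
  have hk : ∀ V : stdSimplex ℝ (Fin d) →ᵇ ℝ,
      Continuous (fun p : stdSimplex ℝ (Fin d) × stdSimplex ℝ (Fin d) =>
        logReward P γ c h w (extendSimplex V) p.1.1 p.2.1) := by
    intro V
    have h1 := (continuous_integral_gain P hγ hwm hw hwi V).log fun y =>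
      (integral_gain_pos P hγ hwm hw hwi (measurable_extendSimplex V.continuous.measurable)
        (extendSimplex_le_norm V) y.2).ne'
    exact hlogs.add (h1.comp continuous_snd)
  choose L hLge hLmax using fun V : stdSimplex ℝ (Fin d) →ᵇ ℝ =>
    exists_maximum_function (X := stdSimplex ℝ (Fin d))
      (K := fun x y => logReward P γ c h w (extendSimplex V) x.1 y.1) (hk V)
  obtain ⟨l, V, hV⟩ := exists_additive_eigenfunction L
    (fun V W k hVW x => by
      obtain ⟨y, hy⟩ := hLmax V x
      have h1 := logReward_le_add P hγ (c := c) (h := h) hwm hw hwi hVW x y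
      linarith [hLge W x y])
    (fun p => -(γ * Real.log (decay c h p.2.1 p.1.1))) (hlogs.comp continuous_swap).neg
    (fun x => by simp [decay_self hc hh x.2])
    (fun V x z => by
      obtain ⟨y, hy⟩ := hLmax V x
      have h1 := logReward_sub_le P hγ hc hh w (extendSimplex V) x.2 y.2 z.2
      linarith [hLge V z y])
  refine ⟨l, V, hk V, fun x => ?_⟩
  rw [← hV]
  exact ⟨hLge V x, hLmax V x⟩

end Bellman

/-! ### Wealth and weights along a strategy -/

section Wealth

variable {Ω : Type*} {d : ℕ} {c h : Fin d → ℝ} {N₀ : Ω → Fin d → ℝ} {S π : ℕ → Ω → Fin d → ℝ}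

theorem shift_apply (hS : ∀ t ω i, 0 < S t ω i) (t : ℕ) (ω : Ω) (i : Fin d) :
    shift S (t + 1) ω i = S (t + 1) ω i / S t ω i := by
  simp only [shift, logReturn, Nat.add_sub_cancel]
  exact Real.exp_log (div_pos (hS _ _ _) (hS _ _ _))

theorem shift_pos (S : ℕ → Ω → Fin d → ℝ) (t : ℕ) (ω : Ω) (i : Fin d) : 0 < shift S t ω i :=
  Real.exp_pos _

/-- The weights `π(t-)` before the rebalancing at time `t`. -/
noncomputable def preWeights (c h : Fin d → ℝ) (N₀ : Ω → Fin d → ℝ) (S π : ℕ → Ω → Fin d → ℝ)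
    (t : ℕ) (ω : Ω) : Fin d → ℝ :=
  drift (preHoldings c h N₀ S π t ω) (S t ω)

theorem preHoldings_succ_mul (hS : ∀ t ω i, 0 < S t ω i) (t : ℕ) (ω : Ω) (i : Fin d) :
    preHoldings c h N₀ S π (t + 1) ω i * S (t + 1) ω i =
      (wealthPre c h N₀ S π t ω * decay c h (preWeights c h N₀ S π t ω) (π t ω)) *
        (π t ω i * shift S (t + 1) ω i) := by
  rw [shift_apply hS]
  simp only [preHoldings, wealthPre, preWeights]
  ring

theorem wealthPre_succ (hS : ∀ t ω i, 0 < S t ω i) (t : ℕ) (ω : Ω) :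
    wealthPre c h N₀ S π (t + 1) ω =
      (wealthPre c h N₀ S π t ω * decay c h (preWeights c h N₀ S π t ω) (π t ω)) *
        (π t ω ⬝ᵥ shift S (t + 1) ω) := by
  rw [wealthPre]
  simp only [dotProduct, preHoldings_succ_mul hS, ← Finset.mul_sum]

theorem preWeights_mem
    (hc : ∀ i, 0 < c i ∧ c i < 1) (hh : ∀ i, 0 < h i ∧ h i < 1)
    (hS : ∀ t ω i, 0 < S t ω i) (hN : ∀ ω i, 0 ≤ N₀ ω i) (hW : ∀ ω, 0 < N₀ ω ⬝ᵥ S 0 ω)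
    (hπ : ∀ t ω, π t ω ∈ stdSimplex ℝ (Fin d)) (t : ℕ) (ω : Ω) :
    preWeights c h N₀ S π t ω ∈ stdSimplex ℝ (Fin d) := by
  obtain ⟨h1, h2, -⟩ := selfFinancing hc hh hS hN hW hπ t ω
  exact drift_mem h1 (hS t ω) h2

theorem preWeights_succ
    (hc : ∀ i, 0 < c i ∧ c i < 1) (hh : ∀ i, 0 < h i ∧ h i < 1)
    (hS : ∀ t ω i, 0 < S t ω i) (hN : ∀ ω i, 0 ≤ N₀ ω i) (hW : ∀ ω, 0 < N₀ ω ⬝ᵥ S 0 ω)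
    (hπ : ∀ t ω, π t ω ∈ stdSimplex ℝ (Fin d)) (t : ℕ) (ω : Ω) :
    preWeights c h N₀ S π (t + 1) ω = drift (π t ω) (shift S (t + 1) ω) := by
  have hx := preWeights_mem hc hh hS hN hW hπ t ω
  have hs := (decay_spec hc hh hx (hπ t ω)).1.1
  have hw : 0 < wealthPre c h N₀ S π t ω := (selfFinancing hc hh hS hN hW hπ t ω).2.1
  funext i
  have e := wealthPre_succ (c := c) (h := h) (N₀ := N₀) (π := π) hS t ω
  rw [wealthPre] at e
  rw [preWeights, drift, drift, e, preHoldings_succ_mul hS,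
    mul_div_mul_left _ _ (mul_pos hw hs).ne']

end Wealth

/-! ### Adaptedness -/

section Measurability

variable {d : ℕ} {c h : Fin d → ℝ}

theorem measurable_dotProduct {Ω : Type*} [MeasurableSpace Ω] {x y : Ω → Fin d → ℝ}
    (hx : Measurable x) (hy : Measurable y) : Measurable fun ω => x ω ⬝ᵥ y ω := by
  unfold dotProduct
  fun_prop

theorem measurable_decay {Ω : Type*} [MeasurableSpace Ω]
    (hc : ∀ i, 0 < c i ∧ c i < 1) (hh : ∀ i, 0 < h i ∧ h i < 1) {x y : Ω → Fin d → ℝ}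
    (hx : Measurable x) (hy : Measurable y) (hxm : ∀ ω, x ω ∈ stdSimplex ℝ (Fin d))
    (hym : ∀ ω, y ω ∈ stdSimplex ℝ (Fin d)) : Measurable fun ω => decay c h (x ω) (y ω) := by
  have h1 : Measurable fun ω => (⟨x ω, hxm ω⟩ : stdSimplex ℝ (Fin d)) := hx.subtype_mk
  have h2 : Measurable fun ω => (⟨y ω, hym ω⟩ : stdSimplex ℝ (Fin d)) := hy.subtype_mk
  have h3 := (continuous_decay hc hh).measurable
  have h4 := h3.comp (h1.prodMk h2)
  exact h4

theorem measurable_rebalance {Ω : Type*} [MeasurableSpace Ω]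
    (hc : ∀ i, 0 < c i ∧ c i < 1) (hh : ∀ i, 0 < h i ∧ h i < 1) {N s y : Ω → Fin d → ℝ}
    (hN : Measurable N) (hs : Measurable s) (hy : Measurable y)
    (hNm : ∀ ω, drift (N ω) (s ω) ∈ stdSimplex ℝ (Fin d))
    (hym : ∀ ω, y ω ∈ stdSimplex ℝ (Fin d)) :
    Measurable fun ω i => (N ω ⬝ᵥ s ω) * decay c h (drift (N ω) (s ω)) (y ω) * y ω i / s ω i := by
  refine measurable_pi_lambda _ fun i => ?_
  exact (((measurable_dotProduct hN hs).mul (measurable_decay hc hh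
    (measurable_drift.comp (hN.prodMk hs)) hy hNm hym)).mul
      ((measurable_pi_apply i).comp hy)).div ((measurable_pi_apply i).comp hs)

theorem measurable_preHoldings {Ω : Type*} {mΩ : MeasurableSpace Ω} {ℱ : Filtration ℕ mΩ}
    (hc : ∀ i, 0 < c i ∧ c i < 1) (hh : ∀ i, 0 < h i ∧ h i < 1)
    {N₀ : Ω → Fin d → ℝ} {S π : ℕ → Ω → Fin d → ℝ} (hS : ∀ t ω i, 0 < S t ω i)
    (hSm : ∀ t, Measurable[ℱ t] (S t)) (hNm : Measurable[ℱ 0] N₀) (hN : ∀ ω i, 0 ≤ N₀ ω i)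
    (hW : ∀ ω, 0 < N₀ ω ⬝ᵥ S 0 ω) (hπ : π ∈ strategies ℱ d) (t : ℕ) :
    Measurable[ℱ t] (preHoldings c h N₀ S π t) := by
  induction t with
  | zero => exact hNm
  | succ t ih =>
    exact (@measurable_rebalance d c h Ω (ℱ t) hc hh _ _ _ ih (hSm t) (hπ.1 t)
      (preWeights_mem hc hh hS hN hW hπ.2 t) (hπ.2 t)).mono (ℱ.mono t.le_succ) le_rfl

end Measurability

/-! ### Growth of the moments of the wealth -/

section Growth

/-- If `R` is independent of a σ-algebra and `Y` is measurable with respect to it, then the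
expectation of `f Y R` is computed by integrating over an independent copy of `R` first. -/
theorem lintegral_eq_lintegral_lintegral_of_indep {Ω E F : Type*} [MeasurableSpace E]
    [MeasurableSpace F] {m mΩ : MeasurableSpace Ω} {P : Measure Ω} [IsProbabilityMeasure P]
    (hm : m ≤ mΩ) {Y : Ω → E} {R : Ω → F}
    (hY : Measurable[m] Y) (hR : Measurable R)
    (hind : Indep (MeasurableSpace.comap R inferInstance) m P)
    {f : E → F → ENNReal} (hf : Measurable fun p : E × F => f p.1 p.2) :
    ∫⁻ ω, f (Y ω) (R ω) ∂P = ∫⁻ ω, ∫⁻ ω', f (Y ω) (R ω') ∂P ∂P := by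
  have hY' : Measurable Y := hY.mono hm le_rfl
  have hYR : IndepFun Y R P := by
    rw [IndepFun_iff_Indep]
    exact (indep_of_indep_of_le_right hind hY.comap_le).symm
  have h1 := (indepFun_iff_map_prod_eq_prod_map_map hY'.aemeasurable hR.aemeasurable).1 hYR
  have : IsProbabilityMeasure (P.map R) := Measure.isProbabilityMeasure_map hR.aemeasurable
  calc ∫⁻ ω, f (Y ω) (R ω) ∂P
      = ∫⁻ p, f p.1 p.2 ∂(P.map fun ω => (Y ω, R ω)) :=
        (lintegral_map hf (hY'.prodMk hR)).symm
    _ = ∫⁻ y, ∫⁻ r, f y r ∂(P.map R) ∂(P.map Y) := by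
        rw [h1, lintegral_prod _ hf.aemeasurable]
    _ = ∫⁻ ω, ∫⁻ r, f (Y ω) r ∂(P.map R) ∂P :=
        lintegral_map hf.lintegral_prod_right' hY'
    _ = _ := by
        refine lintegral_congr fun ω => ?_
        exact lintegral_map (hf.comp (measurable_const.prodMk measurable_id)) hR

variable {Ω : Type*} {mΩ : MeasurableSpace Ω} {P : Measure Ω} {d : ℕ}
  {ℱ : Filtration ℕ mΩ} {c h : Fin d → ℝ} {γ : ℝ} {N₀ : Ω → Fin d → ℝ}
  {S π : ℕ → Ω → Fin d → ℝ} {v : (Fin d → ℝ) → ℝ}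

/-- The expected value of the `γ`-th power of the wealth before the rebalancing at time `t`,
weighted by `exp (v (π(t-)))`. If `v` solves the Bellman equation with constant `l`, then its product with
`exp (-l * t)` is nonincreasing in `t` for all strategies and constant for the optimal ones. -/
noncomputable def weightedMoment (P : Measure Ω) (γ : ℝ) (c h : Fin d → ℝ) (N₀ : Ω → Fin d → ℝ)
    (S π : ℕ → Ω → Fin d → ℝ) (v : (Fin d → ℝ) → ℝ) (t : ℕ) : ENNReal :=
  ∫⁻ ω, ENNReal.ofReal (wealthPre c h N₀ S π t ω ^ γ * Real.exp (v (preWeights c h N₀ S π t ω))) ∂P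

theorem measurable_exp_log_div {Ω : Type*} [MeasurableSpace Ω] {a b : Ω → Fin d → ℝ}
    (ha : Measurable a) (hb : Measurable b) :
    Measurable fun ω i => Real.exp (Real.log (a ω i / b ω i)) :=
  measurable_pi_iff.2 fun i => Real.measurable_exp.comp (Real.measurable_log.comp
    ((measurable_pi_iff.1 ha i).div (measurable_pi_iff.1 hb i)))

theorem measurable_shift (hSm : ∀ t, Measurable[ℱ t] (S t)) (t : ℕ) :
    Measurable[ℱ t] (shift S t) :=
  @measurable_exp_log_div d Ω (ℱ t) _ _ (hSm t)
    ((hSm (t - 1)).mono (ℱ.mono (t.sub_le 1)) le_rfl)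

/-- Conditionally on the past, one period multiplies the weighted wealth by its expected growth
factor `exp (logReward ..)`. -/
theorem weightedMoment_succ [IsProbabilityMeasure P]
    (hc : ∀ i, 0 < c i ∧ c i < 1) (hh : ∀ i, 0 < h i ∧ h i < 1) (hγ : 0 < γ)
    (hS : ∀ t ω i, 0 < S t ω i) (hSm : ∀ t, Measurable[ℱ t] (S t))
    (hindep : ∀ t, Indep (MeasurableSpace.comap (logReturn S (t + 1)) inferInstance) (ℱ t) P)
    (hident : ∀ t, IdentDistrib (logReturn S (t + 1)) (logReturn S 1) P P)
    (hwi : ∀ i, Integrable (fun ω => shift S 1 ω i ^ γ) P)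
    (hv : Measurable v) {C : ℝ} (hC : ∀ x ∈ stdSimplex ℝ (Fin d), v x ≤ C)
    (hNm : Measurable[ℱ 0] N₀) (hN : ∀ ω i, 0 ≤ N₀ ω i) (hW : ∀ ω, 0 < N₀ ω ⬝ᵥ S 0 ω)
    (hπ : π ∈ strategies ℱ d) (t : ℕ) :
    weightedMoment P γ c h N₀ S π v (t + 1) =
      ∫⁻ ω, ENNReal.ofReal (wealthPre c h N₀ S π t ω ^ γ *
        Real.exp (logReward P γ c h (shift S 1) v (preWeights c h N₀ S π t ω) (π t ω))) ∂P := by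
  have hx := preWeights_mem hc hh hS hN hW hπ.2 t
  have hs := fun ω => (decay_spec hc hh (hx ω) (hπ.2 t ω)).1.1
  have hw : ∀ ω, 0 < wealthPre c h N₀ S π t ω := fun ω =>
    (selfFinancing hc hh hS hN hW hπ.2 t ω).2.1
  have hNt := measurable_preHoldings hc hh hS hSm hNm hN hW hπ t
  have hwm : Measurable (shift S 1) := (measurable_shift hSm 1).mono (ℱ.le 1) le_rfl
  -- the factor `(W(t-) s(π(t-), π(t))) ^ γ`, which is known at time `t`
  let A : Ω → ENNReal := fun ω => ENNReal.ofReal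
    ((wealthPre c h N₀ S π t ω * decay c h (preWeights c h N₀ S π t ω) (π t ω)) ^ γ)
  have hA : Measurable[ℱ t] A :=
    ENNReal.measurable_ofReal.comp ((((@measurable_dotProduct d Ω (ℱ t) _ _ hNt (hSm t)).mul
      (@measurable_decay d c h Ω (ℱ t) hc hh _ _ (measurable_drift.comp (hNt.prodMk (hSm t)))
        (hπ.1 t) hx (hπ.2 t)))).pow_const γ)
  have hexp : Measurable fun (r : Fin d → ℝ) i => Real.exp (r i) := by fun_prop
  have hind : Indep (MeasurableSpace.comap (shift S (t + 1)) inferInstance) (ℱ t) P := by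
    refine indep_of_indep_of_le_left (hindep t) ?_
    have e : shift S (t + 1) = (fun (r : Fin d → ℝ) i => Real.exp (r i)) ∘ logReturn S (t + 1) :=
      rfl
    rw [e, ← MeasurableSpace.comap_comp]
    exact MeasurableSpace.comap_mono hexp.comap_le
  have hlaw : IdentDistrib (shift S (t + 1)) (shift S 1) P P := (hident t).comp hexp
  have hstep : ∀ ω, ENNReal.ofReal (wealthPre c h N₀ S π (t + 1) ω ^ γ *
      Real.exp (v (preWeights c h N₀ S π (t + 1) ω))) =
      A ω * ENNReal.ofReal (gain γ v (π t ω) (shift S (t + 1) ω)) := by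
    intro ω
    have h1 := mul_pos (hw ω) (hs ω)
    rw [← ENNReal.ofReal_mul (Real.rpow_nonneg h1.le γ), wealthPre_succ hS,
      preWeights_succ hc hh hS hN hW hπ.2, gain, Real.mul_rpow h1.le
        (dotProduct_pos_of_mem_stdSimplex (hπ.2 t ω) (shift_pos S _ ω)).le, mul_assoc]
  rw [weightedMoment, lintegral_congr hstep,
    lintegral_eq_lintegral_lintegral_of_indep (ℱ.le t) (Y := fun ω => (A ω, π t ω))
      (f := fun p w => p.1 * ENNReal.ofReal (gain γ v p.2 w)) (hA.prodMk (hπ.1 t))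
      ((measurable_shift hSm (t + 1)).mono (ℱ.le _) le_rfl) hind ?_]
  · refine lintegral_congr fun ω => ?_
    have hg : Measurable fun w : Fin d → ℝ => ENNReal.ofReal (gain γ v (π t ω) w) :=
      ENNReal.measurable_ofReal.comp ((measurable_gain hv).comp
        (measurable_const.prodMk measurable_id))
    have hI := integral_gain_pos P hγ hwm (shift_pos S 1) hwi hv hC (hπ.2 t ω)
    have hlaw' : ∫⁻ ω', ENNReal.ofReal (gain γ v (π t ω) (shift S (t + 1) ω')) ∂P =
        ∫⁻ ω', ENNReal.ofReal (gain γ v (π t ω) (shift S 1 ω')) ∂P := (hlaw.comp hg).lintegral_eq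
    simp only
    rw [lintegral_const_mul' _ _ ENNReal.ofReal_ne_top, hlaw',
      ← ofReal_integral_eq_lintegral_ofReal
        (integrable_gain P hγ hwm (shift_pos S 1) hwi hv hC (hπ.2 t ω))
        (Eventually.of_forall fun ω' => (gain_pos (hπ.2 t ω) (shift_pos S 1 ω')).le),
      ← ENNReal.ofReal_mul (Real.rpow_nonneg (mul_pos (hw ω) (hs ω)).le γ),
      Real.mul_rpow (hw ω).le (hs ω).le, logReward, Real.exp_add, Real.exp_log hI,
      Real.rpow_def_of_pos (hs ω), mul_comm γ, mul_assoc]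
  · have h1 : Measurable fun p : (ENNReal × (Fin d → ℝ)) × (Fin d → ℝ) => (p.1.2, p.2) := by
      fun_prop
    have h2 := ENNReal.measurable_ofReal.comp ((measurable_gain hv (γ := γ)).comp h1)
    exact (measurable_fst.comp measurable_fst).mul h2

theorem entropic_log {X : Ω → ℝ} (hX : ∀ ω, 0 < X ω) :
    entropic P γ (fun ω => Real.log (X ω)) =
      ((1 / γ : ℝ) : EReal) * ENNReal.log (∫⁻ ω, ENNReal.ofReal (X ω ^ γ) ∂P) := by
  unfold entropic
  congr 2
  refine lintegral_congr fun ω => ?_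
  rw [Real.rpow_def_of_pos (hX ω), mul_comm]

theorem ereal_log_ofReal_exp (b : ℝ) : ENNReal.log (ENNReal.ofReal (Real.exp b)) = (b : EReal) := by
  rw [ENNReal.log_ofReal_of_pos (Real.exp_pos b), Real.log_exp]

theorem entropic_log_le (hγ : 0 < γ) {X : Ω → ℝ} (hX : ∀ ω, 0 < X ω) {b : ℝ}
    (hle : ∫⁻ ω, ENNReal.ofReal (X ω ^ γ) ∂P ≤ ENNReal.ofReal (Real.exp b)) :
    entropic P γ (fun ω => Real.log (X ω)) ≤ ((1 / γ * b : ℝ) : EReal) := by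
  rw [entropic_log hX, EReal.coe_mul, ← ereal_log_ofReal_exp b]
  exact mul_le_mul_of_nonneg_left (ENNReal.log_le_log hle)
    (EReal.coe_nonneg.2 (one_div_pos.2 hγ).le)

theorem le_entropic_log (hγ : 0 < γ) {X : Ω → ℝ} (hX : ∀ ω, 0 < X ω) {b : ℝ}
    (hle : ENNReal.ofReal (Real.exp b) ≤ ∫⁻ ω, ENNReal.ofReal (X ω ^ γ) ∂P) :
    ((1 / γ * b : ℝ) : EReal) ≤ entropic P γ (fun ω => Real.log (X ω)) := by
  rw [entropic_log hX, EReal.coe_mul, ← ereal_log_ofReal_exp b]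
  exact mul_le_mul_of_nonneg_left (ENNReal.log_le_log hle)
    (EReal.coe_nonneg.2 (one_div_pos.2 hγ).le)

theorem tendsto_affine_div (γ a l : ℝ) :
    Tendsto (fun n : ℕ => ((1 / γ * (a + n * l) : ℝ) : EReal) / (n : EReal)) atTop
      (𝓝 ((l / γ : ℝ) : EReal)) := by
  have h1 : Tendsto (fun n : ℕ => 1 / γ * a / (n : ℝ) + l / γ) atTop (𝓝 (0 + l / γ)) :=
    (tendsto_const_div_atTop_nhds_zero_nat _).add_const _
  rw [zero_add] at h1
  refine ((continuous_coe_real_ereal.tendsto _).comp h1).congr' ?_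
  filter_upwards [eventually_gt_atTop 0] with n hn
  have hn' : (n : ℝ) ≠ 0 := by positivity
  rw [← EReal.coe_coe_eq_natCast, ← EReal.coe_div]
  simp only [Function.comp]
  congr 1
  field_simp

/-- Since `v` is bounded, weighting by `exp v` changes the moments of the wealth by bounded factors
only. -/
theorem lintegral_wealthPre_le_weightedMoment
    (hc : ∀ i, 0 < c i ∧ c i < 1) (hh : ∀ i, 0 < h i ∧ h i < 1)
    (hS : ∀ t ω i, 0 < S t ω i) {C : ℝ} (hC : ∀ x ∈ stdSimplex ℝ (Fin d), |v x| ≤ C)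
    (hN : ∀ ω i, 0 ≤ N₀ ω i) (hW : ∀ ω, 0 < N₀ ω ⬝ᵥ S 0 ω)
    (hπ : ∀ t ω, π t ω ∈ stdSimplex ℝ (Fin d)) (t : ℕ) :
    ∫⁻ ω, ENNReal.ofReal (wealthPre c h N₀ S π t ω ^ γ) ∂P ≤
        ENNReal.ofReal (Real.exp C) * weightedMoment P γ c h N₀ S π v t ∧
      weightedMoment P γ c h N₀ S π v t ≤ ENNReal.ofReal (Real.exp C) *
        ∫⁻ ω, ENNReal.ofReal (wealthPre c h N₀ S π t ω ^ γ) ∂P := by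
  rw [weightedMoment, ← lintegral_const_mul' _ _ ENNReal.ofReal_ne_top,
    ← lintegral_const_mul' _ _ ENNReal.ofReal_ne_top]
  have hw : ∀ ω, 0 ≤ wealthPre c h N₀ S π t ω ^ γ := fun ω =>
    Real.rpow_nonneg (selfFinancing hc hh hS hN hW hπ t ω).2.1.le γ
  have hb := fun ω => abs_le.1 (hC _ (preWeights_mem hc hh hS hN hW hπ t ω))
  constructor <;> refine lintegral_mono fun ω => ?_ <;>
    simp only [← ENNReal.ofReal_mul (Real.exp_pos C).le] <;> refine ENNReal.ofReal_le_ofReal ?_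
  · rw [mul_left_comm, ← Real.exp_add]
    exact le_mul_of_one_le_right (hw ω) (Real.one_le_exp (by linarith [(hb ω).1]))
  · rw [mul_comm]
    exact mul_le_mul_of_nonneg_right (Real.exp_le_exp.2 (hb ω).2) (hw ω)

theorem lintegral_wealthPre_zero [IsProbabilityMeasure P] (hW : ∀ ω, 0 < N₀ ω ⬝ᵥ S 0 ω)
    (hNi : Integrable (fun ω => (N₀ ω ⬝ᵥ S 0 ω) ^ γ) P) :
    ∃ a : ℝ, ∫⁻ ω, ENNReal.ofReal (wealthPre c h N₀ S π 0 ω ^ γ) ∂P =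
      ENNReal.ofReal (Real.exp a) := by
  have hpos : 0 < ∫ ω, (N₀ ω ⬝ᵥ S 0 ω) ^ γ ∂P := by
    rw [integral_pos_iff_support_of_nonneg (fun ω => Real.rpow_nonneg (hW ω).le γ) hNi]
    have : Function.support (fun ω => (N₀ ω ⬝ᵥ S 0 ω) ^ γ) = Set.univ :=
      Set.eq_univ_of_forall fun ω => (Real.rpow_pos_of_pos (hW ω) γ).ne'
    simp [this]
  refine ⟨Real.log (∫ ω, (N₀ ω ⬝ᵥ S 0 ω) ^ γ ∂P), ?_⟩
  rw [Real.exp_log hpos, ofReal_integral_eq_lintegral_ofReal hNi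
    (Eventually.of_forall fun ω => Real.rpow_nonneg (hW ω).le γ)]
  rfl

theorem ofReal_exp_add (a b : ℝ) : ENNReal.ofReal (Real.exp (a + b)) =
    ENNReal.ofReal (Real.exp a) * ENNReal.ofReal (Real.exp b) := by
  rw [Real.exp_add, ENNReal.ofReal_mul (Real.exp_pos a).le]

/-- If the weighted moment grows at most by the factor `exp l` per period, the growth rate of the
strategy is at most `l / γ`. -/
theorem objective_le [IsProbabilityMeasure P] (hγ : 0 < γ)
    (hc : ∀ i, 0 < c i ∧ c i < 1) (hh : ∀ i, 0 < h i ∧ h i < 1)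
    (hS : ∀ t ω i, 0 < S t ω i) {C : ℝ} (hC : ∀ x ∈ stdSimplex ℝ (Fin d), |v x| ≤ C)
    (hN : ∀ ω i, 0 ≤ N₀ ω i) (hW : ∀ ω, 0 < N₀ ω ⬝ᵥ S 0 ω)
    (hNi : Integrable (fun ω => (N₀ ω ⬝ᵥ S 0 ω) ^ γ) P)
    (hπ : ∀ t ω, π t ω ∈ stdSimplex ℝ (Fin d)) {l : ℝ}
    (hM : ∀ t, weightedMoment P γ c h N₀ S π v (t + 1) ≤
      ENNReal.ofReal (Real.exp l) * weightedMoment P γ c h N₀ S π v t) :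
    objective P γ c h N₀ S π ≤ ((l / γ : ℝ) : EReal) := by
  obtain ⟨a, ha⟩ := lintegral_wealthPre_zero (P := P) (γ := γ) (c := c) (h := h) (π := π) hW hNi
  have hb := lintegral_wealthPre_le_weightedMoment (P := P) (γ := γ) hc hh hS hC hN hW hπ
  have hn : ∀ n : ℕ, weightedMoment P γ c h N₀ S π v n ≤
      ENNReal.ofReal (Real.exp (C + a + n * l)) := by
    intro n
    induction n with
    | zero =>
      refine (hb 0).2.trans ?_
      rw [ha, ← ofReal_exp_add]
      simp
    | succ n ih =>
      refine (hM n).trans ((mul_le_mul_right ih _).trans ?_)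
      rw [← ofReal_exp_add]
      refine le_of_eq ?_
      congr 2
      push_cast
      ring
  unfold objective
  rw [← (tendsto_affine_div γ (C + (C + a)) l).liminf_eq]
  refine liminf_le_liminf (Eventually.of_forall fun n => ?_)
  refine EReal.div_le_div_right_of_nonneg (by positivity) (entropic_log_le hγ
    (fun ω => (selfFinancing hc hh hS hN hW hπ n ω).2.1) ?_)
  refine (hb n).1.trans ((mul_le_mul_right (hn n) _).trans ?_)
  rw [← ofReal_exp_add, add_assoc C (C + a)]

/-- If the weighted moment grows at least by the factor `exp l` per period, the growth rate of the
strategy is at least `l / γ`. -/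
theorem le_objective [IsProbabilityMeasure P] (hγ : 0 < γ)
    (hc : ∀ i, 0 < c i ∧ c i < 1) (hh : ∀ i, 0 < h i ∧ h i < 1)
    (hS : ∀ t ω i, 0 < S t ω i) {C : ℝ} (hC : ∀ x ∈ stdSimplex ℝ (Fin d), |v x| ≤ C)
    (hN : ∀ ω i, 0 ≤ N₀ ω i) (hW : ∀ ω, 0 < N₀ ω ⬝ᵥ S 0 ω)
    (hNi : Integrable (fun ω => (N₀ ω ⬝ᵥ S 0 ω) ^ γ) P)
    (hπ : ∀ t ω, π t ω ∈ stdSimplex ℝ (Fin d)) {l : ℝ}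
    (hM : ∀ t, ENNReal.ofReal (Real.exp l) * weightedMoment P γ c h N₀ S π v t ≤
      weightedMoment P γ c h N₀ S π v (t + 1)) :
    ((l / γ : ℝ) : EReal) ≤ objective P γ c h N₀ S π := by
  obtain ⟨a, ha⟩ := lintegral_wealthPre_zero (P := P) (γ := γ) (c := c) (h := h) (π := π) hW hNi
  have hb := lintegral_wealthPre_le_weightedMoment (P := P) (γ := γ) hc hh hS hC hN hW hπ
  have hcancel : ∀ (r : ℝ) {x y : ENNReal}, x ≤ ENNReal.ofReal (Real.exp C) * y →
      x = ENNReal.ofReal (Real.exp (C + r)) → ENNReal.ofReal (Real.exp r) ≤ y := by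
    intro r x y hxy hx
    rw [hx, ofReal_exp_add] at hxy
    exact (ENNReal.mul_le_mul_iff_right (ENNReal.ofReal_pos.2 (Real.exp_pos C)).ne'
      ENNReal.ofReal_ne_top).1 hxy
  have hn : ∀ n : ℕ, ENNReal.ofReal (Real.exp (a - C + n * l)) ≤
      weightedMoment P γ c h N₀ S π v n := by
    intro n
    induction n with
    | zero =>
      refine hcancel _ (hb 0).1 (ha.trans ?_)
      congr 2
      simp
    | succ n ih =>
      refine le_trans ?_ ((mul_le_mul_right ih _).trans (hM n))
      rw [← ofReal_exp_add]
      refine le_of_eq ?_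
      congr 2
      push_cast
      ring
  unfold objective
  rw [← (tendsto_affine_div γ (a - C - C) l).liminf_eq]
  refine liminf_le_liminf (Eventually.of_forall fun n => ?_)
  refine EReal.div_le_div_right_of_nonneg (by positivity) (le_entropic_log hγ
    (fun ω => (selfFinancing hc hh hS hN hW hπ n ω).2.1) ?_)
  refine hcancel _ ((hn n).trans (hb n).2) ?_
  congr 2
  ring

end Growth

/-! ### Feedback strategies -/

section Feedback

variable {Ω : Type*} {mΩ : MeasurableSpace Ω} {ℱ : Filtration ℕ mΩ} {d : ℕ} {c h : Fin d → ℝ}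
  {N₀ : Ω → Fin d → ℝ} {S : ℕ → Ω → Fin d → ℝ} {u : (Fin d → ℝ) → Fin d → ℝ}

theorem feedback_mem_strategies (hum : Measurable u)
    (hu : ∀ x ∈ stdSimplex ℝ (Fin d), u x ∈ stdSimplex ℝ (Fin d))
    (hS : ∀ t ω i, 0 < S t ω i) (hSm : ∀ t, Measurable[ℱ t] (S t))
    (hNm : Measurable[ℱ 0] N₀) (hN : ∀ ω i, 0 ≤ N₀ ω i) (hW : ∀ ω, 0 < N₀ ω ⬝ᵥ S 0 ω) :
    feedback N₀ S u ∈ strategies ℱ d := by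
  refine ⟨fun t => ?_, fun t ω => ?_⟩
  · induction t with
    | zero => exact hum.comp (measurable_drift.comp (hNm.prodMk (hSm 0)))
    | succ t ih =>
      exact hum.comp (measurable_drift.comp
        ((ih.mono (ℱ.mono t.le_succ) le_rfl).prodMk (measurable_shift hSm (t + 1))))
  · induction t with
    | zero => exact hu _ (drift_mem (hN ω) (hS 0 ω) (hW ω))
    | succ t ih => exact hu _ (drift_mem_of_mem ih (shift_pos S _ ω))

theorem feedback_eq_preWeights
    (hc : ∀ i, 0 < c i ∧ c i < 1) (hh : ∀ i, 0 < h i ∧ h i < 1)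
    (hS : ∀ t ω i, 0 < S t ω i) (hN : ∀ ω i, 0 ≤ N₀ ω i) (hW : ∀ ω, 0 < N₀ ω ⬝ᵥ S 0 ω)
    (hf : ∀ t ω, feedback N₀ S u t ω ∈ stdSimplex ℝ (Fin d)) (t : ℕ) (ω : Ω) :
    feedback N₀ S u t ω = u (preWeights c h N₀ S (feedback N₀ S u) t ω) := by
  cases t with
  | zero => rfl
  | succ t =>
    rw [preWeights_succ hc hh hS hN hW hf]
    rfl

end Feedback

end RiskSensitive

open RiskSensitive in
theorem mainTheorem1 {Ω : Type*} {mΩ : MeasurableSpace Ω} (P : Measure Ω) [IsProbabilityMeasure P]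
    (ℱ : Filtration ℕ mΩ) (d : ℕ) (hd : 0 < d)
    (c h : Fin d → ℝ) (hc : ∀ i, 0 < c i ∧ c i < 1) (hh : ∀ i, 0 < h i ∧ h i < 1)
    (γ : ℝ) (hγ : 0 < γ)
    (S : ℕ → Ω → Fin d → ℝ) (hSpos : ∀ t ω i, 0 < S t ω i)
    (hSadapted : ∀ t, Measurable[ℱ t] (S t))
    (hindep : ∀ t, Indep (MeasurableSpace.comap (logReturn S (t + 1)) inferInstance) (ℱ t) P)
    (hident : ∀ t, IdentDistrib (logReturn S (t + 1)) (logReturn S 1) P P)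
    (hentropy : ∀ i, Integrable (fun ω => Real.exp (γ * logReturn S 1 ω i)) P)
    (hmean : ∀ i, Integrable (fun ω => logReturn S 1 ω i) P) :
    ∃ (l : ℝ) (v : (Fin d → ℝ) → ℝ),
      ContinuousOn v (stdSimplex ℝ (Fin d)) ∧
      (∃ C : ℝ, ∀ x ∈ stdSimplex ℝ (Fin d), |v x| ≤ C) ∧
      (∀ x ∈ stdSimplex ℝ (Fin d), ((v x + l : ℝ) : EReal) =
        (γ : EReal) * ⨆ y ∈ stdSimplex ℝ (Fin d), bellmanTerm P γ c h (shift S 1) v x y) ∧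
      (∃ u, IsSelector P γ c h (shift S 1) v u) ∧
      (∀ N₀ : Ω → Fin d → ℝ, Measurable[ℱ 0] N₀ → (∀ ω i, 0 ≤ N₀ ω i) →
        (∀ ω, 0 < N₀ ω ⬝ᵥ S 0 ω) → Integrable (fun ω => (N₀ ω ⬝ᵥ S 0 ω) ^ γ) P →
        ((l / γ : ℝ) : EReal) = (⨆ π ∈ strategies ℱ d, objective P γ c h N₀ S π) ∧
        ∀ u, IsSelector P γ c h (shift S 1) v u →
          feedback N₀ S u ∈ strategies ℱ d ∧
          objective P γ c h N₀ S (feedback N₀ S u) = ((l / γ : ℝ) : EReal)) := by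
  have : Nonempty (Fin d) := ⟨⟨0, hd⟩⟩
  have hwm : Measurable (shift S 1) := (measurable_shift hSadapted 1).mono (ℱ.le 1) le_rfl
  have hw := shift_pos S 1
  have hwi : ∀ i, Integrable (fun ω => shift S 1 ω i ^ γ) P := fun i =>
    (hentropy i).congr (Eventually.of_forall fun ω => by
      simp only [shift]
      rw [← Real.exp_mul, mul_comm])
  obtain ⟨l, V, hcont, hV⟩ := exists_bellman_solution hd P hγ hc hh hwm hw hwi
  set v := extendSimplex V with hv_def
  have hv : Measurable v := measurable_extendSimplex V.continuous.measurable
  have hC : ∀ x ∈ stdSimplex ℝ (Fin d), |v x| ≤ ‖V‖ := fun x hx => by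
    rw [hv_def, extendSimplex_of_mem _ hx]
    exact V.norm_coe_le_norm _
  have hvC : ∀ x ∈ stdSimplex ℝ (Fin d), v x ≤ ‖V‖ := extendSimplex_le_norm V
  have hle : ∀ x ∈ stdSimplex ℝ (Fin d), ∀ y ∈ stdSimplex ℝ (Fin d),
      logReward P γ c h (shift S 1) v x y ≤ v x + l := fun x hx y hy => by
    have := (hV ⟨x, hx⟩).1 ⟨y, hy⟩
    rwa [← extendSimplex_of_mem V hx] at this
  have hex : ∀ x ∈ stdSimplex ℝ (Fin d), ∃ y ∈ stdSimplex ℝ (Fin d),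
      logReward P γ c h (shift S 1) v x y = v x + l := fun x hx => by
    obtain ⟨y, hy⟩ := (hV ⟨x, hx⟩).2
    rw [← extendSimplex_of_mem V hx] at hy
    exact ⟨y.1, y.2, hy⟩
  have hterm := fun (x : Fin d → ℝ) (hx : x ∈ stdSimplex ℝ (Fin d)) (y : Fin d → ℝ)
    (hy : y ∈ stdSimplex ℝ (Fin d)) =>
    bellmanTerm_eq_logReward P hγ hc hh hwm hw hwi hv hvC hx hy
  have hγ' : 0 < 1 / γ := one_div_pos.2 hγ
  -- the selectors of the Bellman equation are the maximisers of `logReward`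
  have hmax : ∀ x ∈ stdSimplex ℝ (Fin d), ∀ y ∈ stdSimplex ℝ (Fin d),
      (IsMaxOn (bellmanTerm P γ c h (shift S 1) v x) (stdSimplex ℝ (Fin d)) y ↔
        logReward P γ c h (shift S 1) v x y = v x + l) := by
    intro x hx y hy
    constructor
    · intro hm
      obtain ⟨z, hz, hz'⟩ := hex x hx
      have h1 := isMaxOn_iff.1 hm z hz
      rw [hterm x hx z hz, hterm x hx y hy, EReal.coe_le_coe_iff, hz'] at h1
      exact le_antisymm (hle x hx y hy) (le_of_mul_le_mul_left h1 hγ')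
    · intro he
      refine isMaxOn_iff.2 fun z hz => ?_
      rw [hterm x hx z hz, hterm x hx y hy, EReal.coe_le_coe_iff, he]
      exact mul_le_mul_of_nonneg_left (hle x hx z hz) hγ'.le
  have hsel : ∃ u, IsSelector P γ c h (shift S 1) v u := by
    obtain ⟨u, hum, hu⟩ := exists_measurable_selection
      (R := {p : stdSimplex ℝ (Fin d) × stdSimplex ℝ (Fin d) |
        logReward P γ c h (shift S 1) v p.1.1 p.2.1 = V p.1 + l})
      (isClosed_eq hcont ((V.continuous.comp continuous_fst).add continuous_const))
      fun x => (hV x).2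
    let e : (Fin d → ℝ) → Fin d → ℝ := Function.extend Subtype.val (fun x => (u x).1) 0
    have he : ∀ x (hx : x ∈ stdSimplex ℝ (Fin d)), e x = (u ⟨x, hx⟩).1 := fun x hx =>
      Subtype.val_injective.extend_apply (fun x => (u x).1) 0 (⟨x, hx⟩ : stdSimplex ℝ (Fin d))
    refine ⟨e, ?_, fun x hx => ?_⟩
    · exact (MeasurableEmbedding.subtype_coe
        (isClosed_stdSimplex ℝ (Fin d)).measurableSet).measurable_extend
          (measurable_subtype_coe.comp hum) measurable_const
    · rw [he x hx]
      refine ⟨(u ⟨x, hx⟩).2, (hmax x hx _ (u ⟨x, hx⟩).2).2 ?_⟩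
      rw [hv_def, extendSimplex_of_mem _ hx]
      exact hu ⟨x, hx⟩
  refine ⟨l, v, ?_, ⟨‖V‖, hC⟩, fun x hx => ?_, hsel, fun N₀ hNm hN hW hNi => ?_⟩
  · rw [continuousOn_iff_continuous_domRestrict]
    refine V.continuous.congr fun x => ?_
    exact (extendSimplex_coe _ x).symm
  · have hsup : ⨆ y ∈ stdSimplex ℝ (Fin d), bellmanTerm P γ c h (shift S 1) v x y =
        ((1 / γ * (v x + l) : ℝ) : EReal) := by
      refine le_antisymm (iSup₂_le fun y hy => ?_) ?_
      · rw [hterm x hx y hy, EReal.coe_le_coe_iff]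
        exact mul_le_mul_of_nonneg_left (hle x hx y hy) hγ'.le
      · obtain ⟨y, hy, hy'⟩ := hex x hx
        refine le_iSup₂_of_le y hy ?_
        rw [hterm x hx y hy, hy']
    rw [hsup, ← EReal.coe_mul]
    congr 1
    field_simp
  · have hstep := fun (π : ℕ → Ω → Fin d → ℝ) (hπ : π ∈ strategies ℱ d) =>
      weightedMoment_succ (P := P) hc hh hγ hSpos hSadapted hindep hident hwi hv hvC hNm hN hW hπ
    have hbell : ∀ π ∈ strategies ℱ d, ∀ t, ENNReal.ofReal (Real.exp l) *
        weightedMoment P γ c h N₀ S π v t = ∫⁻ ω, ENNReal.ofReal (wealthPre c h N₀ S π t ω ^ γ *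
          Real.exp (v (preWeights c h N₀ S π t ω) + l)) ∂P := by
      intro π hπ t
      rw [weightedMoment, ← lintegral_const_mul' _ _ ENNReal.ofReal_ne_top]
      refine lintegral_congr fun ω => ?_
      rw [← ENNReal.ofReal_mul (Real.exp_pos l).le, Real.exp_add]
      congr 1
      ring
    -- the Bellman inequality makes the discounted weighted moment nonincreasing
    have hup : ∀ π ∈ strategies ℱ d, objective P γ c h N₀ S π ≤ ((l / γ : ℝ) : EReal) := by
      intro π hπ
      refine objective_le hγ hc hh hSpos hC hN hW hNi hπ.2 fun t => ?_
      rw [hstep π hπ, hbell π hπ]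
      refine lintegral_mono fun ω => ENNReal.ofReal_le_ofReal ?_
      exact mul_le_mul_of_nonneg_left (Real.exp_le_exp.2
        (hle _ (preWeights_mem hc hh hSpos hN hW hπ.2 t ω) _ (hπ.2 t ω)))
        (Real.rpow_nonneg (selfFinancing hc hh hSpos hN hW hπ.2 t ω).2.1.le γ)
    -- for a selector the Bellman inequality is an equality at every step
    have hopt : ∀ u, IsSelector P γ c h (shift S 1) v u → feedback N₀ S u ∈ strategies ℱ d ∧
        objective P γ c h N₀ S (feedback N₀ S u) = ((l / γ : ℝ) : EReal) := by
      intro u hu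
      have hπ : feedback N₀ S u ∈ strategies ℱ d :=
        feedback_mem_strategies hu.1 (fun x hx => (hu.2 x hx).1) hSpos hSadapted hNm hN hW
      refine ⟨hπ, le_antisymm (hup _ hπ)
        (le_objective hγ hc hh hSpos hC hN hW hNi hπ.2 fun t => ?_)⟩
      rw [hstep _ hπ, hbell _ hπ]
      refine le_of_eq (lintegral_congr fun ω => ?_)
      have hx := preWeights_mem hc hh hSpos hN hW hπ.2 t ω
      rw [feedback_eq_preWeights hc hh hSpos hN hW hπ.2 t ω,
        (hmax _ hx _ (hu.2 _ hx).1).1 (hu.2 _ hx).2]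
    refine ⟨le_antisymm ?_ (iSup₂_le hup), hopt⟩
    obtain ⟨u, hu⟩ := hsel
    obtain ⟨hu1, hu2⟩ := hopt u hu
    exact le_iSup₂_of_le _ hu1 hu2.ge
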